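/- Let $k$ be a field of characteristic $0$ and $n\ge 2$. Let $B_n$ be the braid group with its standard generators $\sigma_1,\dots,\sigma_{n-1}$. Let $\mathcal T_n$ be the Lie algebra over $k$ generated by $t_{ij}$ ($1\le i,j\le n$) with relations $t_{ij}=t_{ji}$, $t_{ii}=0$, $[t_{ij},t_{lm}]=0$ if $i,j,l,m$ are distinct, and $[t_{ij},t_{il}+t_{lj}]=0$; let $\mathfrak B_n=k\mathfrak S_n\ltimes U\mathcal T_n$ with $s\,t_{ij}\,s^{-1}=t_{s(i)s(j)}$. It is a Hopf algebra in which the $t_{ij}$ are primitive and the permutations group-like, and it is graded by $\deg t_{ij}=1$, $\deg s=0$. Put $s_i=(i\ i{+}1)$ and $Y_r=\sum_{i<r}t_{ir}$. For $\lambda\in k$, let $\mathrm{Assoc}_\lambda(k)$ be the set of formal series $\Phi(A,B)$ in two non-commuting variables over $k$ such that $\Delta(\Phi)=\Phi\hat\otimes\Phi$ (with $A$, $B$ primitive), $\Phi(B,A)=\Phi(A,B)^{-1}$, $e^{\lambda A}\Phi(C,A)e^{\lambda C}\Phi(B,C)e^{\lambda B}\Phi(A,B)=1$ with $C=-A-B$,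 and, in the completion of $U\mathcal T_4$, $$\Phi(t_{12},t_{23}+t_{24})\,\Phi(t_{13}+t_{23},t_{34})=\Phi(t_{23},t_{34})\,\Phi(t_{12}+t_{13},t_{24}+t_{34})\,\Phi(t_{12},t_{23}).$$ Let $\Phi\in\mathrm{Assoc}_\lambda(k)$ with $\lambda\neq0$. Representations are finite-dimensional matrix representations. For every representation $\rho:\mathfrak B_n\to M_N(k)$ there is a unique representation $\widehat\Phi(\rho)$ of $B_n$ over $k[[h]]$ such that $$\widehat\Phi(\rho)(\sigma_i)=\Phi\big(h\rho(t_{i,i+1}),h\rho(Y_i)\big)\,\rho(s_i)\,e^{\lambda h\rho(t_{i,i+1})}\,\Phi\big(h\rho(Y_i),h\rho(t_{i,i+1})\big)\qquad(1\le i<n).$$ Let $A$ be a subring of $k[[h]]$ containing $k[h]$ which is a discrete valuation ring with local parameter $h$, such that $\widehat\Phi(\rho)(B_n)\subset GL_N(A)$ for all $N>0$ and all $\rho:\mathfrak B_n\to M_N(k)$ (for instance $A=k[[h]]$), and let $K$ be its field of fractions; consider $\widehat\Phi(\rho)$ as a representation over $A$. A representation over $A$ is called indecomposable if it is nonzero and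 is not the direct sum of two nonzero invariant submodules, and (absolutely) irreducible if it is so over $K$. Then: 1. $\widehat\Phi(\rho)$ is indecomposable over $A$ if and only if $\rho$ is indecomposable; $\widehat\Phi(\rho)$ is irreducible if and only if $\rho$ is irreducible; $\widehat\Phi(\rho)$ is absolutely irreducible if and only if $\rho$ is absolutely irreducible. 2. $\widehat\Phi(\rho_1\oplus\rho_2)=\widehat\Phi(\rho_1)\oplus\widehat\Phi(\rho_2)$, $\widehat\Phi(\rho_1\otimes\rho_2)=\widehat\Phi(\rho_1)\otimes\widehat\Phi(\rho_2)$ and $\widehat\Phi(\rho^\vee)=\widehat\Phi(\rho)^\vee$. 3. For all representations $\rho_1:\mathfrak B_n\to M_{N_1}(k)$ and $\rho_2:\mathfrak B_n\to M_{N_2}(k)$, $$\mathrm{Hom}_A(\widehat\Phi(\rho_1),\widehat\Phi(\rho_2))=\mathrm{Hom}_k(\rho_1,\rho_2)\otimes_k A,\qquad \mathrm{Hom}_K(\widehat\Phi(\rho_1),\widehat\Phi(\rho_2))=\mathrm{Hom}_k(\rho_1,\rho_2)\otimes_k K,$$ that is, for $S\in\{A,K\}$ the canonical map $\mathrm{Hom}_k(\rho_1,\rho_2)\otimes_k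 S\to M_{N_2\times N_1}(S)$ is injective with image $\mathrm{Hom}_S(\widehat\Phi(\rho_1),\widehat\Phi(\rho_2))$. -/

import Mathlib

open scoped TensorProduct

namespace InfBraid

universe u v

/-! ### Braid groups -/

/-- The braid relations: `σᵢ σⱼ σᵢ = σⱼ σᵢ σⱼ` if `j = i + 1`, and `σᵢ σⱼ = σⱼ σᵢ` if `j ≥ i + 2`.
The generators are indexed from `0`. -/
def braidRels (n : ℕ) : Set (FreeGroup (Fin (n - 1))) :=
  {r | ∃ i j : Fin (n - 1), (i : ℕ) + 1 = j ∧
    r = FreeGroup.of i * FreeGroup.of j * FreeGroup.of i *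
      (FreeGroup.of j * FreeGroup.of i * FreeGroup.of j)⁻¹} ∪
  {r | ∃ i j : Fin (n - 1), (i : ℕ) + 2 ≤ j ∧
    r = FreeGroup.of i * FreeGroup.of j * (FreeGroup.of j * FreeGroup.of i)⁻¹}

/-- The braid group `Bₙ` on `n` strands. -/
abbrev BraidGroup (n : ℕ) : Type := PresentedGroup (braidRels n)

/-- The standard generators of `Bₙ`. -/
def sigma {n : ℕ} (i : Fin (n - 1)) : BraidGroup n := PresentedGroup.of i

/-- The lower strand of the `i`-th generator. -/
def lo {n : ℕ} (i : Fin (n - 1)) : Fin n := ⟨i, by omega⟩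

/-- The upper strand of the `i`-th generator. -/
def hi {n : ℕ} (i : Fin (n - 1)) : Fin n := ⟨(i : ℕ) + 1, by omega⟩

/-! ### Infinitesimal pure braids -/

/-- The free Lie generator attached to the pair `(i, j)`. -/
noncomputable def freeT (k : Type u) [Field k] {n : ℕ} (i j : Fin n) : FreeLieAlgebra k (Fin n × Fin n) :=
  FreeLieAlgebra.of k (i, j)

/-- The defining relators of the Lie algebra of infinitesimal pure braids. -/
inductive TRel (k : Type u) [Field k] (n : ℕ) : FreeLieAlgebra k (Fin n × Fin n) → Prop
  | symm (i j : Fin n) : TRel k n (freeT k i j - freeT k j i)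
  | diag (i : Fin n) : TRel k n (freeT k i i)
  | comm (i j l m : Fin n) (h : [i, j, l, m].Nodup) : TRel k n ⁅freeT k i j, freeT k l m⁆
  | tri (i j l : Fin n) : TRel k n ⁅freeT k i j, freeT k i l + freeT k l j⁆

/-- The ideal generated by the relators. -/
noncomputable def TIdeal (k : Type u) [Field k] (n : ℕ) : LieIdeal k (FreeLieAlgebra k (Fin n × Fin n)) :=
  LieSubmodule.lieSpan k (FreeLieAlgebra k (Fin n × Fin n)) {x | TRel k n x}

/-- The Lie algebra `𝒯ₙ` of infinitesimal pure braids on `n` strands, over `k`. -/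
abbrev TLie (k : Type u) [Field k] (n : ℕ) : Type u :=
  FreeLieAlgebra k (Fin n × Fin n) ⧸ TIdeal k n

/-- The enveloping algebra `U 𝒯ₙ`. -/
abbrev UT (k : Type u) [Field k] (n : ℕ) : Type u := UniversalEnvelopingAlgebra k (TLie k n)

/-- The generator `tᵢⱼ` of `𝒯ₙ`. -/
noncomputable def tLie (k : Type u) [Field k] {n : ℕ} (i j : Fin n) : TLie k n :=
  LieSubmodule.Quotient.mk (freeT k i j)

/-- The generator `tᵢⱼ`, as an element of `U 𝒯ₙ`. -/
noncomputable def tU (k : Type u) [Field k] {n : ℕ} (i j : Fin n) : UT k n :=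
  UniversalEnvelopingAlgebra.ι k (tLie k i j)

/-- A family of elements of an associative algebra satisfying the relations of the `tᵢⱼ`. -/
structure TFamily {n : ℕ} {B : Type v} [Ring B] (f : Fin n → Fin n → B) : Prop where
  symm : ∀ i j, f i j = f j i
  diag : ∀ i, f i i = 0
  comm : ∀ i j l m, [i, j, l, m].Nodup → f i j * f l m = f l m * f i j
  tri : ∀ i j l, f i j * (f i l + f l j) = (f i l + f l j) * f i j

section Lift

attribute [local instance 100] LieRing.ofAssociativeRing

variable {k : Type u} [Field k] {n : ℕ}

theorem tLie_symm (i j : Fin n) : tLie k i j = tLie k j i := by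
  have : freeT k i j - freeT k j i ∈ TIdeal k n := LieSubmodule.subset_lieSpan (TRel.symm i j)
  exact (Submodule.Quotient.eq _).2 this

theorem tLie_diag (i : Fin n) : tLie k i i = 0 :=
  LieSubmodule.Quotient.mk_eq_zero'.2 (LieSubmodule.subset_lieSpan (TRel.diag i))

theorem tLie_comm (i j l m : Fin n) (h : [i, j, l, m].Nodup) : ⁅tLie k i j, tLie k l m⁆ = 0 :=
  LieSubmodule.Quotient.mk_eq_zero'.2 (LieSubmodule.subset_lieSpan (TRel.comm i j l m h))

theorem tLie_tri (i j l : Fin n) : ⁅tLie k i j, tLie k i l + tLie k l j⁆ = 0 :=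
  LieSubmodule.Quotient.mk_eq_zero'.2 (LieSubmodule.subset_lieSpan (TRel.tri i j l))

/-- The `tᵢⱼ` satisfy their defining relations in `U 𝒯ₙ`. -/
theorem tFamily_tU : TFamily (tU k (n := n)) where
  symm i j := by simp only [tU, tLie_symm i j]
  diag i := by simp only [tU, tLie_diag, map_zero]
  comm i j l m h := by
    have := congrArg (UniversalEnvelopingAlgebra.ι k) (tLie_comm (k := k) i j l m h)
    rw [LieHom.map_lie, map_zero, LieRing.of_associative_ring_bracket] at this
    exact sub_eq_zero.1 this
  tri i j l := by
    have := congrArg (UniversalEnvelopingAlgebra.ι k) (tLie_tri (k := k) i j l)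
    rw [LieHom.map_lie, map_zero, LieRing.of_associative_ring_bracket, map_add] at this
    exact sub_eq_zero.1 this

variable {B : Type v} [Ring B] [Algebra k B]

/-- The Lie algebra morphism out of `𝒯ₙ` defined by the images of the generators. -/
noncomputable def liftT (f : Fin n → Fin n → B) (hf : TFamily f) : TLie k n →ₗ⁅k⁆ B :=
  let F : FreeLieAlgebra k (Fin n × Fin n) →ₗ⁅k⁆ B := FreeLieAlgebra.lift k fun p => f p.1 p.2
  have hF : TIdeal k n ≤ F.ker := by
    refine LieSubmodule.lieSpan_le.2 ?_
    have e : ∀ i j, F (freeT k i j) = f i j := fun i j => FreeLieAlgebra.lift_of_apply _ _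
    rintro x (⟨i, j⟩ | ⟨i⟩ | ⟨i, j, l, m, h⟩ | ⟨i, j, l⟩) <;>
      refine LieHom.mem_ker.2 ?_
    · rw [map_sub, e, e, hf.symm i j, sub_self]
    · rw [e, hf.diag]
    · rw [LieHom.map_lie, e, e, LieRing.of_associative_ring_bracket, hf.comm i j l m h, sub_self]
    · rw [LieHom.map_lie, map_add, e, e, e, LieRing.of_associative_ring_bracket, hf.tri, sub_self]
  { (TIdeal k n).toSubmodule.liftQ (F : FreeLieAlgebra k (Fin n × Fin n) →ₗ[k] B)
      (fun x hx => LieHom.mem_ker.1 (hF hx)) with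
    map_lie' := by
      rintro ⟨x⟩ ⟨y⟩
      exact F.map_lie x y }

theorem liftT_tLie (f : Fin n → Fin n → B) (hf : TFamily f) (i j : Fin n) :
    liftT (k := k) f hf (tLie k i j) = f i j :=
  FreeLieAlgebra.lift_of_apply _ _

/-- The algebra morphism out of `U 𝒯ₙ` defined by the images of the generators. -/
noncomputable def liftUT (f : Fin n → Fin n → B) (hf : TFamily f) : UT k n →ₐ[k] B :=
  UniversalEnvelopingAlgebra.lift k (liftT f hf)

theorem liftUT_tU (f : Fin n → Fin n → B) (hf : TFamily f) (i j : Fin n) :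
    liftUT (k := k) f hf (tU k i j) = f i j :=
  (UniversalEnvelopingAlgebra.lift_ι_apply k _ _).trans (liftT_tLie f hf i j)

theorem UT_hom_ext {f g : UT k n →ₐ[k] B} (h : ∀ i j, f (tU k i j) = g (tU k i j)) : f = g := by
  apply UniversalEnvelopingAlgebra.hom_ext
  refine LieHom.ext fun x => ?_
  obtain ⟨y, rfl⟩ := LieSubmodule.Quotient.surjective_mk' (TIdeal k n) x
  let q : FreeLieAlgebra k (Fin n × Fin n) →ₗ⁅k⁆ TLie k n :=
    { (LieSubmodule.Quotient.mk' (TIdeal k n) :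
        FreeLieAlgebra k (Fin n × Fin n) →ₗ[k] TLie k n) with
      map_lie' := fun {_ _} => rfl }
  have : (((f : UT k n →ₗ⁅k⁆ B).comp (UniversalEnvelopingAlgebra.ι k)).comp q) =
      (((g : UT k n →ₗ⁅k⁆ B).comp (UniversalEnvelopingAlgebra.ι k)).comp q) := by
    apply FreeLieAlgebra.hom_ext
    intro p
    exact h p.1 p.2
  exact LieHom.congr_fun this y

end Lift

/-! ### The action of the symmetric group and the algebra `𝔅ₙ` -/

section InfBraidAlgebra

variable (k : Type u) [Field k] (n : ℕ)

/-- The automorphism `tᵢⱼ ↦ t_{s(i)s(j)}` of `U 𝒯ₙ`. -/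
noncomputable def permUT (s : Equiv.Perm (Fin n)) : UT k n →ₐ[k] UT k n :=
  liftUT (fun i j => tU k (s i) (s j))
    { symm := fun _ _ => tFamily_tU.symm _ _
      diag := fun _ => tFamily_tU.diag _
      comm := fun _ _ _ _ h => tFamily_tU.comm _ _ _ _ (h.map (f := s) s.injective)
      tri := fun _ _ _ => tFamily_tU.tri _ _ _ }

theorem permUT_tU (s : Equiv.Perm (Fin n)) (i j : Fin n) :
    permUT k n s (tU k i j) = tU k (s i) (s j) := liftUT_tU _ _ _ _

theorem permUT_one : permUT k n 1 = AlgHom.id k _ :=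
  UT_hom_ext fun i j => permUT_tU k n 1 i j

theorem permUT_mul (s s' : Equiv.Perm (Fin n)) :
    permUT k n (s * s') = (permUT k n s).comp (permUT k n s') :=
  UT_hom_ext fun i j => by simp [permUT_tU]

/-- The action of the symmetric group on `U 𝒯ₙ`. -/
noncomputable instance : MulSemiringAction (Equiv.Perm (Fin n)) (UT k n) where
  smul s x := permUT k n s x
  one_smul x := by change permUT k n 1 x = x; rw [permUT_one]; rfl
  mul_smul s s' x := by
    change permUT k n (s * s') x = permUT k n s (permUT k n s' x); rw [permUT_mul]; rfl
  smul_zero s := map_zero (permUT k n s)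
  smul_add s := map_add (permUT k n s)
  smul_one s := map_one (permUT k n s)
  smul_mul s := map_mul (permUT k n s)

theorem perm_smul_def (s : Equiv.Perm (Fin n)) (x : UT k n) : s • x = permUT k n s x := rfl

theorem perm_smul_tU (s : Equiv.Perm (Fin n)) (i j : Fin n) :
    s • tU k i j = tU k (s i) (s j) := permUT_tU k n s i j

instance : SMulCommClass (Equiv.Perm (Fin n)) k (UT k n) where
  smul_comm s c x := map_smul (permUT k n s) c x

/-- The algebra `𝔅ₙ = k 𝔖ₙ ⋉ U 𝒯ₙ` of infinitesimal braids: its elements are sums of products `x s`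
with `x ∈ U 𝒯ₙ` and `s ∈ 𝔖ₙ`, and `s x = (s • x) s`. -/
abbrev InfBraidAlgebra : Type u := SkewMonoidAlgebra (UT k n) (Equiv.Perm (Fin n))

variable {n}

/-- The element `tᵢⱼ` of `𝔅ₙ`. -/
noncomputable def t (i j : Fin n) : InfBraidAlgebra k n := SkewMonoidAlgebra.single 1 (tU k i j)

/-- The element of `𝔅ₙ` given by a permutation. -/
noncomputable def perm (s : Equiv.Perm (Fin n)) : InfBraidAlgebra k n :=
  SkewMonoidAlgebra.single s 1

/-- The element `Yᵣ = ∑_{i < r} tᵢᵣ`. -/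
noncomputable def Y (r : Fin n) : InfBraidAlgebra k n := ∑ i ∈ Finset.Iio r, t k i r

theorem perm_mul (s s' : Equiv.Perm (Fin n)) : perm k (s * s') = perm k s * perm k s' := by
  simp [perm, SkewMonoidAlgebra.single_mul_single]

theorem perm_one : perm k (1 : Equiv.Perm (Fin n)) = 1 := rfl

theorem perm_mul_t (s : Equiv.Perm (Fin n)) (i j : Fin n) :
    perm k s * t k i j = t k (s i) (s j) * perm k s := by
  simp [perm, t, SkewMonoidAlgebra.single_mul_single, perm_smul_tU]

theorem tFamily_t : TFamily (t k (n := n)) where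
  symm i j := by simp only [t, tFamily_tU.symm i j]
  diag i := by simp only [t, tFamily_tU.diag, SkewMonoidAlgebra.single_zero]
  comm i j l m h := by
    simp only [t, SkewMonoidAlgebra.single_mul_single, one_smul, tFamily_tU.comm i j l m h]
  tri i j l := by
    simp only [t, ← SkewMonoidAlgebra.single_add, SkewMonoidAlgebra.single_mul_single, one_smul,
      tFamily_tU.tri i j l]

variable {k}
variable {B : Type v} [Ring B] [Algebra k B]

/-- The universal property of `𝔅ₙ`: an algebra morphism is given by the images of the `tᵢⱼ` and of
the permutations. -/
noncomputable def liftB (f : Fin n → Fin n → B) (hf : TFamily f) (g : Equiv.Perm (Fin n) →* B)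
    (hfg : ∀ s i j, g s * f i j = f (s i) (s j) * g s) : InfBraidAlgebra k n →ₐ[k] B :=
  SkewMonoidAlgebra.liftNCAlgHom (liftUT f hf) g (by
    intro x s
    have hs : g s * g s⁻¹ = 1 := by rw [← map_mul, mul_inv_cancel, map_one]
    have hs' : g s⁻¹ * g s = 1 := by rw [← map_mul, inv_mul_cancel, map_one]
    let c : B →ₐ[k] B := AlgHom.ofLinearMap
      (LinearMap.mulLeft k (g s) ∘ₗ LinearMap.mulRight k (g s⁻¹)) (by simp [hs])
      (fun a b => by
        simp only [LinearMap.comp_apply, LinearMap.mulLeft_apply, LinearMap.mulRight_apply]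
        calc g s * (a * b * g s⁻¹) = g s * a * 1 * b * g s⁻¹ := by simp only [mul_assoc, one_mul]
          _ = g s * (a * g s⁻¹) * (g s * (b * g s⁻¹)) := by rw [← hs']; simp only [mul_assoc])
    have key : (liftUT f hf).comp (permUT k n s) = c.comp (liftUT f hf) := by
      apply UT_hom_ext
      intro i j
      change liftUT f hf (permUT k n s (tU k i j)) = g s * (liftUT f hf (tU k i j) * g s⁻¹)
      rw [permUT_tU, liftUT_tU, liftUT_tU, ← mul_assoc, hfg, mul_assoc, hs, mul_one]
    have := DFunLike.congr_fun key x
    change liftUT f hf (permUT k n s x) = g s * (liftUT f hf x * g s⁻¹) at this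
    rw [perm_smul_def, this, mul_assoc, mul_assoc, hs', mul_one])

theorem liftB_t (f : Fin n → Fin n → B) (hf : TFamily f) (g : Equiv.Perm (Fin n) →* B)
    (hfg : ∀ s i j, g s * f i j = f (s i) (s j) * g s) (i j : Fin n) :
    liftB (k := k) f hf g hfg (t k i j) = f i j := by
  simp [liftB, t, SkewMonoidAlgebra.liftNCAlgHom, SkewMonoidAlgebra.liftNCRingHom, liftUT_tU]

theorem liftB_perm (f : Fin n → Fin n → B) (hf : TFamily f) (g : Equiv.Perm (Fin n) →* B)
    (hfg : ∀ s i j, g s * f i j = f (s i) (s j) * g s) (s : Equiv.Perm (Fin n)) :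
    liftB (k := k) f hf g hfg (perm k s) = g s := by
  simp [liftB, perm, SkewMonoidAlgebra.liftNCAlgHom, SkewMonoidAlgebra.liftNCRingHom]

theorem B_hom_ext {f g : InfBraidAlgebra k n →ₐ[k] B} (ht : ∀ i j, f (t k i j) = g (t k i j))
    (hs : ∀ s, f (perm k s) = g (perm k s)) : f = g := by
  let inc : UT k n →ₐ[k] InfBraidAlgebra k n :=
    { toFun := SkewMonoidAlgebra.single 1
      map_one' := rfl
      map_mul' := fun x y => by simp [SkewMonoidAlgebra.single_mul_single]
      map_zero' := SkewMonoidAlgebra.single_zero _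
      map_add' := fun x y => SkewMonoidAlgebra.single_add _ _ _
      commutes' := fun c => rfl }
  have h1 : f.comp inc = g.comp inc := UT_hom_ext ht
  have h2 : (f : InfBraidAlgebra k n →+ B) = (g : InfBraidAlgebra k n →+ B) := by
    apply SkewMonoidAlgebra.addHom_ext
    intro s x
    have e : SkewMonoidAlgebra.single s x = inc x * perm k s := by
      change _ = SkewMonoidAlgebra.single 1 x * SkewMonoidAlgebra.single s 1
      simp [SkewMonoidAlgebra.single_mul_single]
    have h3 := DFunLike.congr_fun h1 x
    change f (inc x) = g (inc x) at h3
    change f _ = g _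
    rw [e, map_mul, map_mul, h3, hs]
  exact AlgHom.ext fun x => DFunLike.congr_fun h2 x

variable (k n)

/-- The comultiplication of `𝔅ₙ`: the `tᵢⱼ` are primitive, the permutations are group-like. -/
noncomputable def comul : InfBraidAlgebra k n →ₐ[k] InfBraidAlgebra k n ⊗[k] InfBraidAlgebra k n :=
  liftB (fun i j => t k i j ⊗ₜ[k] (1 : InfBraidAlgebra k n) +
      (1 : InfBraidAlgebra k n) ⊗ₜ[k] t k i j)
    { symm := fun i j => by rw [(tFamily_t k).symm i j]
      diag := fun i => by rw [(tFamily_t k).diag i]; simp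
      comm := fun i j l m h => by
        have := (tFamily_t k).comm i j l m h
        simp only [mul_add, add_mul, Algebra.TensorProduct.tmul_mul_tmul, one_mul, mul_one, this]
        abel
      tri := fun i j l => by
        have := (tFamily_t k).tri i j l
        have e : ∀ a b : InfBraidAlgebra k n,
            (a ⊗ₜ[k] (1 : InfBraidAlgebra k n) + (1 : InfBraidAlgebra k n) ⊗ₜ[k] a) +
              (b ⊗ₜ[k] (1 : InfBraidAlgebra k n) + (1 : InfBraidAlgebra k n) ⊗ₜ[k] b) =
            (a + b) ⊗ₜ[k] (1 : InfBraidAlgebra k n) +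
              (1 : InfBraidAlgebra k n) ⊗ₜ[k] (a + b) := by
          intro a b; rw [TensorProduct.add_tmul, TensorProduct.tmul_add]; abel
        rw [e]
        generalize t k i l + t k l j = y at this
        simp only [mul_add, add_mul, Algebra.TensorProduct.tmul_mul_tmul, one_mul, mul_one, this]
        abel }
    { toFun := fun s => perm k s ⊗ₜ[k] perm k s
      map_one' := rfl
      map_mul' := fun s s' => by rw [Algebra.TensorProduct.tmul_mul_tmul, perm_mul] }
    (fun s i j => by
      change perm k s ⊗ₜ[k] perm k s * _ = _ * perm k s ⊗ₜ[k] perm k s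
      simp only [mul_add, add_mul, Algebra.TensorProduct.tmul_mul_tmul, perm_mul_t, one_mul,
        mul_one])

/-- The antipode of `𝔅ₙ`, as a morphism to the opposite algebra: `tᵢⱼ ↦ -tᵢⱼ`, `s ↦ s⁻¹`. -/
noncomputable def antipode : InfBraidAlgebra k n →ₐ[k] (InfBraidAlgebra k n)ᵐᵒᵖ :=
  liftB (fun i j => MulOpposite.op (-t k i j))
    { symm := fun i j => by rw [(tFamily_t k).symm i j]
      diag := fun i => by rw [(tFamily_t k).diag i]; simp
      comm := fun i j l m h => by
        simp only [← MulOpposite.op_mul, neg_mul_neg, (tFamily_t k).comm i j l m h]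
      tri := fun i j l => by
        simp only [← MulOpposite.op_mul, ← MulOpposite.op_add, ← neg_add, neg_mul_neg,
          (tFamily_t k).tri i j l] }
    { toFun := fun s => MulOpposite.op (perm k s⁻¹)
      map_one' := by rw [inv_one, perm_one, MulOpposite.op_one]
      map_mul' := fun s s' => by rw [← MulOpposite.op_mul, mul_inv_rev, perm_mul] }
    (fun s i j => by
      change MulOpposite.op (perm k s⁻¹) * _ = _ * MulOpposite.op (perm k s⁻¹)
      have := perm_mul_t k s⁻¹ (s i) (s j)
      rw [show s⁻¹ (s i) = i from s.symm_apply_apply i,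
        show s⁻¹ (s j) = j from s.symm_apply_apply j] at this
      rw [← MulOpposite.op_mul, ← MulOpposite.op_mul, neg_mul, mul_neg, this])

end InfBraidAlgebra

/-! ### Associators

If `𝒜` is a graded algebra, its completion `∏ 𝒜ₘ` is the algebra of those power series
`∑ aₘ hᵐ` over `𝒜` such that `aₘ` is homogeneous of degree `m`. Elements of completed graded
algebras are written below as power series in this way: the variable records the degree. -/

section Associators

variable {k : Type u} [Field k]

/-- Formal series in two noncommuting variables (numbered `0` and `1`), given by the coefficients
of the words. -/
abbrev NCSeries (k : Type u) : Type u := FreeMonoid (Fin 2) → k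

variable {𝒜 : Type v} [Ring 𝒜] [Algebra k 𝒜]

/-- The value `Φ(x, y)` at elements `x`, `y` of degree one: its part of degree `m` is the sum of
the terms of `Φ` which are words of length `m`, evaluated at `x`, `y`. -/
noncomputable def eval (Φ : NCSeries k) (x y : 𝒜) : PowerSeries 𝒜 :=
  PowerSeries.mk fun m => ∑ w : Fin m → Fin 2,
    Φ (FreeMonoid.ofList (List.ofFn w)) • (List.ofFn fun i => ![x, y] (w i)).prod

/-- The exponential `e^{cx}`, where `x` has degree one and `c` is a scalar. -/
noncomputable def expo (c : k) (x : 𝒜) : PowerSeries 𝒜 :=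
  PowerSeries.mk fun m => ((m.factorial : k)⁻¹ * c ^ m) • x ^ m

/-- The free algebra on the two variables. -/
abbrev Free2 (k : Type u) [Field k] : Type u := FreeAlgebra k (Fin 2)

/-- The first variable. -/
def varA (k : Type u) [Field k] : Free2 k := FreeAlgebra.ι k 0

/-- The second variable. -/
def varB (k : Type u) [Field k] : Free2 k := FreeAlgebra.ι k 1

/-- The set of associators with parameter `lam` over `k`. -/
structure IsAssociator (lam : k) (Φ : NCSeries k) : Prop where
  /-- `Δ(Φ) = Φ ⊗̂ Φ`, where `Δ` is the continuous morphism for which the variables are primitive. -/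
  grouplike : eval Φ (varA k ⊗ₜ[k] (1 : Free2 k) + (1 : Free2 k) ⊗ₜ[k] varA k)
      (varB k ⊗ₜ[k] (1 : Free2 k) + (1 : Free2 k) ⊗ₜ[k] varB k) =
    eval Φ (varA k ⊗ₜ[k] (1 : Free2 k)) (varB k ⊗ₜ[k] (1 : Free2 k)) *
      eval Φ ((1 : Free2 k) ⊗ₜ[k] varA k) ((1 : Free2 k) ⊗ₜ[k] varB k)
  /-- `Φ(B, A) = Φ(A, B)⁻¹`. -/
  inverse : eval Φ (varB k) (varA k) * eval Φ (varA k) (varB k) = 1 ∧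
    eval Φ (varA k) (varB k) * eval Φ (varB k) (varA k) = 1
  /-- The hexagonal relation, with `C = -A - B`. -/
  hexagon : expo lam (varA k) * eval Φ (-varA k - varB k) (varA k) *
      expo lam (-varA k - varB k) * eval Φ (varB k) (-varA k - varB k) *
      expo lam (varB k) * eval Φ (varA k) (varB k) = 1
  /-- The pentagonal relation, in the completion of `U 𝒯₄` (the strands are numbered from `0`). -/
  pentagon : eval Φ (tU k (0 : Fin 4) 1) (tU k 1 2 + tU k 1 3) *
      eval Φ (tU k 0 2 + tU k 1 2) (tU k 2 3) =
    eval Φ (tU k 1 2) (tU k 2 3) * eval Φ (tU k 0 1 + tU k 0 2) (tU k 1 3 + tU k 2 3) *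
      eval Φ (tU k 0 1) (tU k 1 2)

/-- The element `Φ(t_{i,i+1}, Yᵢ) sᵢ e^{λ t_{i,i+1}} Φ(Yᵢ, t_{i,i+1})` of the completion of `𝔅ₙ`. -/
noncomputable def drinfeldElt {n : ℕ} (lam : k) (Φ : NCSeries k) (i : Fin (n - 1)) :
    PowerSeries (InfBraidAlgebra k n) :=
  eval Φ (t k (lo i) (hi i)) (Y k (lo i)) *
    PowerSeries.C (perm k (Equiv.swap (lo i) (hi i))) *
    expo lam (t k (lo i) (hi i)) *
    eval Φ (Y k (lo i)) (t k (lo i) (hi i))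

end Associators

/-! ### Matrix representations -/

section Representations

variable {k : Type u} [Field k] {n : ℕ} {ι κ : Type*} [Fintype ι] [DecidableEq ι]
  [Fintype κ] [DecidableEq κ]

/-- The extension of `ρ` to the completion of `𝔅ₙ`, with `tᵢⱼ` acting by `h ρ(tᵢⱼ)`:
a series whose part of degree `m` is `aₘ` acts by `∑ ρ(aₘ) hᵐ`. -/
noncomputable def extendRep (ρ : InfBraidAlgebra k n →ₐ[k] Matrix ι ι k)
    (a : PowerSeries (InfBraidAlgebra k n)) : Matrix ι ι (PowerSeries k) :=
  Matrix.of fun x y => PowerSeries.mk fun m => ρ (PowerSeries.coeff m a) x y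

/-- `R` is the representation `Φ̂(ρ)` of `Bₙ` over `k[[h]]`. -/
def IsPhiHat (lam : k) (Φ : NCSeries k) (ρ : InfBraidAlgebra k n →ₐ[k] Matrix ι ι k)
    (R : BraidGroup n →* Matrix ι ι (PowerSeries k)) : Prop :=
  ∀ i : Fin (n - 1), R (sigma i) = extendRep ρ (drinfeldElt lam Φ i)

/-- Extension of scalars of a matrix representation of a group. -/
def mapRep {G S T : Type*} [Group G] [CommRing S] [CommRing T] (f : S →+* T)
    (R : G →* Matrix ι ι S) : G →* Matrix ι ι T :=
  (f.mapMatrix : Matrix ι ι S →+* Matrix ι ι T).toMonoidHom.comp R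

/-- `R` is the representation `Φ̂(ρ)`, considered over the subring `A` of `k[[h]]`. -/
def IsPhiHatOver (A : Subalgebra k (PowerSeries k)) (lam : k) (Φ : NCSeries k)
    (ρ : InfBraidAlgebra k n →ₐ[k] Matrix ι ι k) (R : BraidGroup n →* Matrix ι ι A) : Prop :=
  IsPhiHat lam Φ ρ (mapRep (A.val : A →+* PowerSeries k) R)

/-- `A` contains `k[h]` and is a discrete valuation ring with local parameter `h`; its valuation
is then the restriction of the `h`-adic valuation of `k[[h]]`. -/
structure IsDiscreteValuationSubring (A : Subalgebra k (PowerSeries k)) : Prop where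
  X_mem : PowerSeries.X ∈ A
  isDVR : IsDiscreteValuationRing A
  irreducible_X : Irreducible (⟨PowerSeries.X, X_mem⟩ : A)

/-- Direct sum of representations of `𝔅ₙ`. -/
noncomputable def dsumAlg (ρ₁ : InfBraidAlgebra k n →ₐ[k] Matrix ι ι k)
    (ρ₂ : InfBraidAlgebra k n →ₐ[k] Matrix κ κ k) :
    InfBraidAlgebra k n →ₐ[k] Matrix (ι ⊕ κ) (ι ⊕ κ) k where
  toFun x := Matrix.fromBlocks (ρ₁ x) 0 0 (ρ₂ x)
  map_one' := by simp
  map_mul' x y := by simp [Matrix.fromBlocks_multiply]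
  map_zero' := by simp
  map_add' x y := by simp [Matrix.fromBlocks_add]
  commutes' c := by
    rw [AlgHom.commutes, AlgHom.commutes, Matrix.algebraMap_eq_diagonal,
      Matrix.algebraMap_eq_diagonal, Matrix.algebraMap_eq_diagonal, Matrix.fromBlocks_diagonal]
    congr 1
    ext (x | x) <;> rfl

/-- Tensor product of representations of `𝔅ₙ`, through the comultiplication and the isomorphism
`M_ι(k) ⊗ M_κ(k) ≃ M_{ι × κ}(k)` given by the Kronecker product. -/
noncomputable def tensorAlg (ρ₁ : InfBraidAlgebra k n →ₐ[k] Matrix ι ι k)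
    (ρ₂ : InfBraidAlgebra k n →ₐ[k] Matrix κ κ k) :
    InfBraidAlgebra k n →ₐ[k] Matrix (ι × κ) (ι × κ) k :=
  ((Matrix.kroneckerAlgEquiv ι κ k).toAlgHom.comp (Algebra.TensorProduct.map ρ₁ ρ₂)).comp (comul k n)

/-- Dual of a representation of `𝔅ₙ`: `x` acts by the transpose of the antipode of `x`. -/
noncomputable def dualAlg (ρ : InfBraidAlgebra k n →ₐ[k] Matrix ι ι k) :
    InfBraidAlgebra k n →ₐ[k] Matrix ι ι k :=
  (Matrix.transposeAlgEquiv ι k k).symm.toAlgHom.comp ((AlgHom.op ρ).comp (antipode k n))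

variable {G : Type*} [Group G] {S : Type*} [CommRing S]

/-- Direct sum of matrix representations of a group. -/
def dsumGrp (R₁ : G →* Matrix ι ι S) (R₂ : G →* Matrix κ κ S) :
    G →* Matrix (ι ⊕ κ) (ι ⊕ κ) S where
  toFun g := Matrix.fromBlocks (R₁ g) 0 0 (R₂ g)
  map_one' := by simp
  map_mul' x y := by simp [Matrix.fromBlocks_multiply]

/-- Tensor product of matrix representations of a group. -/
def tensorGrp (R₁ : G →* Matrix ι ι S) (R₂ : G →* Matrix κ κ S) :
    G →* Matrix (ι × κ) (ι × κ) S where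
  toFun g := Matrix.kronecker (R₁ g) (R₂ g)
  map_one' := by simp [Matrix.kronecker]
  map_mul' x y := by simp [Matrix.kronecker, Matrix.mul_kronecker_mul]

/-- Dual of a matrix representation of a group. -/
def dualGrp (R : G →* Matrix ι ι S) : G →* Matrix ι ι S where
  toFun g := (R g⁻¹).transpose
  map_one' := by simp
  map_mul' x y := by simp

/-! The following notions are defined for an arbitrary family of operators `M`, and used for
the family of all `ρ(x)`, `x ∈ 𝔅ₙ`, and for the family of all `R(g)`, `g ∈ Bₙ`. -/

/-- Invariant submodules of `S^ι`. -/
def IsInvariant {Γ : Type*} (M : Γ → Matrix ι ι S) (W : Submodule S (ι → S)) : Prop :=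
  ∀ g, ∀ v ∈ W, (M g).mulVec v ∈ W

/-- `S^ι` is nonzero and is not the direct sum of two nonzero invariant submodules. -/
def IsIndecomposable {Γ : Type*} (M : Γ → Matrix ι ι S) : Prop :=
  Nonempty ι ∧ ∀ W₁ W₂ : Submodule S (ι → S), IsInvariant M W₁ → IsInvariant M W₂ →
    IsCompl W₁ W₂ → W₁ = ⊥ ∨ W₂ = ⊥

/-- Over a field `F`: `F^ι` is nonzero and its only invariant subspaces are `0` and `F^ι`. -/
def IsIrred {F : Type*} [Field F] {Γ : Type*} (M : Γ → Matrix ι ι F) : Prop :=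
  Nonempty ι ∧ ∀ W : Submodule F (ι → F), IsInvariant M W → W = ⊥ ∨ W = ⊤

/-- Irreducibility after every extension of the base field. -/
def IsAbsIrred {F : Type u} [Field F] {Γ : Type*} (M : Γ → Matrix ι ι F) : Prop :=
  ∀ (L : Type u) [Field L] [Algebra F L], IsIrred fun g => (M g).map (algebraMap F L)

/-- The module of intertwiners between two families of operators with the same index set. -/
def intertwiners {Γ : Type*} (M₁ : Γ → Matrix ι ι S) (M₂ : Γ → Matrix κ κ S) :
    Submodule S (Matrix κ ι S) where
  carrier := {f | ∀ g, f * M₁ g = M₂ g * f}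
  zero_mem' g := by simp
  add_mem' {a b} ha hb g := by rw [Matrix.add_mul, Matrix.mul_add, ha g, hb g]
  smul_mem' c a ha g := by rw [Matrix.smul_mul, Matrix.mul_smul, ha g]

/-- The canonical map `T ⊗ Hom(M₁, M₂) → M_{κ × ι}(T)`, `a ⊗ f ↦ a f`, for an `S`-algebra `T`. -/
noncomputable def intertwinersBaseChange {Γ : Type*} (M₁ : Γ → Matrix ι ι S)
    (M₂ : Γ → Matrix κ κ S) (T : Type*) [CommRing T] [Algebra S T] :
    T ⊗[S] intertwiners M₁ M₂ →ₗ[T] Matrix κ ι T :=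
  LinearMap.liftBaseChange T
    ((Algebra.linearMap S T).mapMatrix ∘ₗ (intertwiners M₁ M₂).subtype)

end Representations

end InfBraid

namespace InfBraid

/-! ### Evaluation of noncommutative series and exponentials -/

section Series

variable {k : Type*} [Field k] {𝒜 ℬ : Type*} [Ring 𝒜] [Algebra k 𝒜] [Ring ℬ] [Algebra k ℬ]

/-! Everything happens in the completion of `𝔅ₙ`, realized inside power series over it. The elements
`drinfeldElt` are invertible and satisfy the braid relations there, so there is one universal
morphism `braidSeries` from `Bₙ`, and `Φ̂(ρ)` is `ρ` applied to it coefficient by coefficient. The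
relation for distant generators is pure commutation. For neighbouring generators, the strands to the
left are bundled into one strand, the pentagon conjugates the two elements into a three-strand
situation, and the hexagon settles that one (`braid_three`, `braid_four`).

Compatibility with tensor products and duals says that `drinfeldElt` is group-like: the coproduct
doubles it, and the antipode inverts it. Both follow from the group-likeness of `Φ`, since the `tᵢⱼ`
and `Yᵣ` are primitive.

The remaining statements rest on the fact that `𝔅ₙ` can be recovered from the braid action. Since
`Φ` has constant term 1 and no linear term, `σᵢ = sᵢ + O(h)` and `σᵢ² = 1 + 2λh t_{i,i+1} + O(h²)`.
As `λ ≠ 0` and the characteristic is zero, the leading terms give all `sᵢ` and `t_{i,i+1}`, which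
generate `𝔅ₙ`. Hence the constant term of an intertwiner of braid representations intertwines the
representations of `𝔅ₙ`. Subtracting it and dividing by `h` gives the same for every coefficient
(`matCoeff_intertwine`), so intertwiners over `A` are the base change of those over `k`; clearing
denominators gives the case of `K`.

Indecomposability is then a matter of idempotents in the commutant, and an idempotent over `A` is
zero as soon as it vanishes modulo `h`. For irreducibility, an invariant subspace over `k` extends
to `K`; conversely an invariant subspace `W` over `K` meets `A^ι` in a lattice whose reduction at `h
= 0` is invariant under `sᵢ` and under `(σᵢ² - 1)/h`, hence under `𝔅ₙ`, and the reduction is neither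
zero nor everything if `W` is not. Absolute irreducibility means irreducibility with scalar
commutant (Schur and Burnside), and both conditions have already been transferred. -/

theorem coeff_eval (Φ : NCSeries k) (x y : 𝒜) (m : ℕ) :
    PowerSeries.coeff m (eval Φ x y) = ∑ w : Fin m → Fin 2,
      Φ (FreeMonoid.ofList (List.ofFn w)) • (List.ofFn fun i => ![x, y] (w i)).prod :=
  PowerSeries.coeff_mk _ _

theorem coeff_expo (c : k) (x : 𝒜) (m : ℕ) :
    PowerSeries.coeff m (expo c x) = ((m.factorial : k)⁻¹ * c ^ m) • x ^ m :=
  PowerSeries.coeff_mk _ _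

/-- Naturality of evaluation. It carries the axioms of an associator, stated for universal
variables, to arbitrary algebras. -/
theorem map_eval (f : 𝒜 →ₐ[k] ℬ) (Φ : NCSeries k) (x y : 𝒜) :
    PowerSeries.map (f : 𝒜 →+* ℬ) (eval Φ x y) = eval Φ (f x) (f y) := by
  ext m
  rw [PowerSeries.coeff_map, coeff_eval, coeff_eval]
  simp only [RingHom.coe_coe, map_sum, map_smul, map_list_prod, List.map_ofFn]
  refine Finset.sum_congr rfl fun w _ => ?_
  congr 3
  funext i
  simp only [Function.comp]
  generalize w i = j
  fin_cases j <;> rfl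

theorem map_expo (f : 𝒜 →ₐ[k] ℬ) (c : k) (x : 𝒜) :
    PowerSeries.map (f : 𝒜 →+* ℬ) (expo c x) = expo c (f x) := by
  ext m
  simp [coeff_expo]

theorem prod_ofFn_semiconj (s : 𝒜) (m : ℕ) (u u' : Fin m → 𝒜) (h : ∀ i, s * u i = u' i * s) :
    s * (List.ofFn u).prod = (List.ofFn u').prod * s := by
  induction m with
  | zero => simp
  | succ m ih =>
    simp only [List.ofFn_succ, List.prod_cons]
    rw [← mul_assoc, h, mul_assoc, ih _ _ fun i => h i.succ, mul_assoc]

theorem coeff_eval_semiconj (Φ : NCSeries k) {s x y x' y' : 𝒜} (hx : s * x = x' * s)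
    (hy : s * y = y' * s) (m : ℕ) :
    s * PowerSeries.coeff m (eval Φ x y) = PowerSeries.coeff m (eval Φ x' y') * s := by
  rw [coeff_eval, coeff_eval, Finset.mul_sum, Finset.sum_mul]
  refine Finset.sum_congr rfl fun w _ => ?_
  rw [mul_smul_comm, smul_mul_assoc, prod_ofFn_semiconj]
  intro i
  generalize w i = j
  fin_cases j
  · exact hx
  · exact hy

theorem C_mul_eval (Φ : NCSeries k) {s x y x' y' : 𝒜} (hx : s * x = x' * s)
    (hy : s * y = y' * s) :
    PowerSeries.C s * eval Φ x y = eval Φ x' y' * PowerSeries.C s := by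
  ext m
  rw [PowerSeries.coeff_C_mul, PowerSeries.coeff_mul_C, coeff_eval_semiconj Φ hx hy]

theorem coeff_expo_semiconj (c : k) {s x x' : 𝒜} (hx : s * x = x' * s) (m : ℕ) :
    s * PowerSeries.coeff m (expo c x) = PowerSeries.coeff m (expo c x') * s := by
  rw [coeff_expo, coeff_expo, mul_smul_comm, smul_mul_assoc]
  have : SemiconjBy s x x' := hx
  rw [(this.pow_right m).eq]

theorem C_mul_expo (c : k) {s x x' : 𝒜} (hx : s * x = x' * s) :
    PowerSeries.C s * expo c x = expo c x' * PowerSeries.C s := by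
  ext m
  rw [PowerSeries.coeff_C_mul, PowerSeries.coeff_mul_C, coeff_expo_semiconj c hx]

/-- Power series with pairwise commuting coefficients commute. -/
theorem commute_of_coeff {a b : PowerSeries 𝒜}
    (h : ∀ i j, Commute (PowerSeries.coeff i a) (PowerSeries.coeff j b)) : Commute a b := by
  ext m
  rw [PowerSeries.coeff_mul, PowerSeries.coeff_mul, ← Finset.Nat.sum_antidiagonal_swap]
  exact Finset.sum_congr rfl fun p _ => h _ _

theorem commute_coeff_eval (Φ : NCSeries k) {s x y : 𝒜} (hx : Commute s x) (hy : Commute s y)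
    (m : ℕ) : Commute s (PowerSeries.coeff m (eval Φ x y)) :=
  coeff_eval_semiconj Φ hx.eq hy.eq m

theorem commute_coeff_expo (c : k) {s x : 𝒜} (hx : Commute s x) (m : ℕ) :
    Commute s (PowerSeries.coeff m (expo c x)) :=
  coeff_expo_semiconj c hx.eq m

theorem commute_eval_eval (Φ : NCSeries k) {x y x' y' : 𝒜} (h1 : Commute x x')
    (h2 : Commute x y') (h3 : Commute y x') (h4 : Commute y y') :
    Commute (eval Φ x y) (eval Φ x' y') :=
  commute_of_coeff fun i j => commute_coeff_eval Φ
    (commute_coeff_eval Φ h1.symm h3.symm i).symm (commute_coeff_eval Φ h2.symm h4.symm i).symm j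

theorem commute_expo_eval (Φ : NCSeries k) (c : k) {x x' y' : 𝒜} (h1 : Commute x x')
    (h2 : Commute x y') : Commute (expo c x) (eval Φ x' y') :=
  commute_of_coeff fun i j => commute_coeff_eval Φ
    (commute_coeff_expo c h1.symm i).symm (commute_coeff_expo c h2.symm i).symm j

theorem commute_expo_expo (c c' : k) {x x' : 𝒜} (h1 : Commute x x') :
    Commute (expo c x) (expo c' x') :=
  commute_of_coeff fun i j => commute_coeff_expo c' (commute_coeff_expo c h1.symm i).symm j

theorem commute_C_eval (Φ : NCSeries k) {s x y : 𝒜} (hx : Commute s x) (hy : Commute s y) :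
    Commute (PowerSeries.C s) (eval Φ x y) := C_mul_eval Φ hx.eq hy.eq

theorem commute_C_expo (c : k) {s x : 𝒜} (hx : Commute s x) :
    Commute (PowerSeries.C s) (expo c x) := C_mul_expo c hx.eq

theorem expo_zero (c : k) : expo c (0 : 𝒜) = 1 := by
  ext m
  rw [coeff_expo, PowerSeries.coeff_one]
  rcases eq_or_ne m 0 with rfl | hm
  · simp
  · simp [hm]

theorem expo_add [CharZero k] (c : k) {x y : 𝒜} (h : Commute x y) :
    expo c (x + y) = expo c x * expo c y := by
  ext m
  rw [coeff_expo, PowerSeries.coeff_mul, h.add_pow', Finset.smul_sum]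
  refine Finset.sum_congr rfl fun p hp => ?_
  rw [Finset.HasAntidiagonal.mem_antidiagonal] at hp
  rw [coeff_expo, coeff_expo, smul_mul_smul_comm, ← Nat.cast_smul_eq_nsmul k, smul_smul]
  congr 1
  rw [← hp, pow_add, Nat.choose_symm_add, Nat.add_choose, Nat.cast_div (Nat.factorial_mul_factorial_dvd_factorial_add _ _)
    (by exact_mod_cast mul_ne_zero (Nat.factorial_ne_zero _) (Nat.factorial_ne_zero _))]
  have h0 : ((p.1 + p.2).factorial : k) ≠ 0 := by exact_mod_cast Nat.factorial_ne_zero _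
  have h1 : (p.1.factorial : k) ≠ 0 := by exact_mod_cast Nat.factorial_ne_zero _
  have h2 : (p.2.factorial : k) ≠ 0 := by exact_mod_cast Nat.factorial_ne_zero _
  push_cast
  field_simp

theorem expo_neg_mul_expo [CharZero k] (c : k) (x : 𝒜) : expo c (-x) * expo c x = 1 := by
  rw [← expo_add c (Commute.neg_left (Commute.refl x)), neg_add_cancel, expo_zero]

theorem expo_mul_expo_neg [CharZero k] (c : k) (x : 𝒜) : expo c x * expo c (-x) = 1 := by
  rw [← expo_add c (Commute.neg_right (Commute.refl x)), add_neg_cancel, expo_zero]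

theorem coeff_zero_eval (Φ : NCSeries k) (x y : 𝒜) :
    PowerSeries.coeff 0 (eval Φ x y) = Φ 1 • (1 : 𝒜) := by
  rw [coeff_eval]
  simp

theorem coeff_one_eval (Φ : NCSeries k) (x y : 𝒜) :
    PowerSeries.coeff 1 (eval Φ x y) =
      Φ (FreeMonoid.of 0) • x + Φ (FreeMonoid.of 1) • y := by
  rw [coeff_eval, Fintype.sum_equiv (Equiv.funUnique (Fin 1) (Fin 2)) _
    (fun j => Φ (FreeMonoid.of j) • ![x, y] j), Fin.sum_univ_two]
  · rfl
  · intro w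
    simp [List.ofFn_succ, Equiv.funUnique]

/-- Homogeneity under doubling; compared with group-likeness, it forces the positive-degree part to
vanish in `IsAssociator.eval_of_commute`. -/
theorem coeff_eval_add_self (Φ : NCSeries k) (x y : 𝒜) (m : ℕ) :
    PowerSeries.coeff m (eval Φ (x + x) (y + y)) =
      (2 : k) ^ m • PowerSeries.coeff m (eval Φ x y) := by
  have key : ∀ (m : ℕ) (w : Fin m → Fin 2), (List.ofFn fun i => ![x + x, y + y] (w i)).prod =
      (2 : k) ^ m • (List.ofFn fun i => ![x, y] (w i)).prod := by
    intro m
    induction m with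
    | zero => intro w; simp
    | succ m ih =>
      intro w
      simp only [List.ofFn_succ, List.prod_cons]
      have h0 : ![x + x, y + y] (w 0) = (2 : k) • ![x, y] (w 0) := by
        generalize w 0 = j
        fin_cases j <;> simp [two_smul]
      rw [ih (fun i => w i.succ), h0, smul_mul_smul_comm, ← pow_succ']
  rw [coeff_eval, coeff_eval, Finset.smul_sum]
  exact Finset.sum_congr rfl fun w _ => by rw [key, smul_comm]

end Series

/-! ### Consequences of the associator axioms in arbitrary algebras -/

section GroupLike

variable {k : Type*} [Field k] {𝒜 : Type*} [Ring 𝒜] [Algebra k 𝒜]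
  {lam : k} {Φ : NCSeries k}

theorem commute_freeLift {x y a : 𝒜} (hx : Commute a x) (hy : Commute a y) (u : Free2 k) :
    Commute a (FreeAlgebra.lift k ![x, y] u) := by
  induction u using FreeAlgebra.induction with
  | grade0 r => rw [AlgHom.commutes]; exact Algebra.commute_algebraMap_right _ _
  | grade1 i =>
    rw [FreeAlgebra.lift_ι_apply]
    fin_cases i
    · exact hx
    · exact hy
  | mul u v hu hv => rw [map_mul]; exact hu.mul_right hv
  | add u v hu hv => rw [map_add]; exact hu.add_right hv

/-- Two commuting pairs define a morphism from the tensor square of the free algebra, and the image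
of the group-like axiom under it is this identity. -/
theorem IsAssociator.eval_add (hΦ : IsAssociator lam Φ) {x₁ y₁ x₂ y₂ : 𝒜} (hxx : Commute x₁ x₂)
    (hxy : Commute x₁ y₂) (hyx : Commute y₁ x₂) (hyy : Commute y₁ y₂) :
    eval Φ (x₁ + x₂) (y₁ + y₂) = eval Φ x₁ y₁ * eval Φ x₂ y₂ := by
  let F : Free2 k ⊗[k] Free2 k →ₐ[k] 𝒜 := Algebra.TensorProduct.lift
    (FreeAlgebra.lift k ![x₁, y₁]) (FreeAlgebra.lift k ![x₂, y₂]) fun u v =>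
      commute_freeLift (commute_freeLift hxx.symm hyx.symm u).symm
        (commute_freeLift hxy.symm hyy.symm u).symm v
  have := congrArg (PowerSeries.map (F : _ →+* 𝒜)) hΦ.grouplike
  rw [map_mul, map_eval, map_eval, map_eval] at this
  simpa [F, varA, varB] using this

theorem IsAssociator.eval_mul_eval_swap (hΦ : IsAssociator lam Φ) (x y : 𝒜) :
    eval Φ x y * eval Φ y x = 1 := by
  have := congrArg (PowerSeries.map (FreeAlgebra.lift k ![x, y] : Free2 k →+* 𝒜)) hΦ.inverse.2
  rw [map_mul, map_eval, map_eval, map_one] at this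
  simpa [varA, varB] using this

/-- The constant term `c` satisfies `c² = 1` by the inversion axiom and `c = c²` by group-likeness.
-/
theorem IsAssociator.apply_one (hΦ : IsAssociator lam Φ) : Φ 1 = 1 := by
  have h1 := congrArg (PowerSeries.coeff 0) (hΦ.eval_mul_eval_swap (0 : k) 0)
  have h2 := congrArg (PowerSeries.coeff 0) (hΦ.eval_add (Commute.zero_left (0 : k))
    (Commute.zero_left (0 : k)) (Commute.zero_left _) (Commute.zero_left _))
  simp only [PowerSeries.coeff_mul, Finset.Nat.antidiagonal_zero, Finset.sum_singleton, coeff_zero_eval,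
    PowerSeries.coeff_one, smul_eq_mul, mul_one, if_true] at h1 h2
  rw [h2, h1]

theorem IsAssociator.coeff_zero (hΦ : IsAssociator lam Φ) (x y : 𝒜) :
    PowerSeries.coeff 0 (eval Φ x y) = 1 := by
  rw [coeff_zero_eval, hΦ.apply_one, one_smul]

theorem IsAssociator.pentagon_of_tFamily (hΦ : IsAssociator lam Φ) {f : Fin 4 → Fin 4 → 𝒜}
    (hf : TFamily f) :
    eval Φ (f 0 1) (f 1 2 + f 1 3) * eval Φ (f 0 2 + f 1 2) (f 2 3) =
      eval Φ (f 1 2) (f 2 3) * eval Φ (f 0 1 + f 0 2) (f 1 3 + f 2 3) *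
        eval Φ (f 0 1) (f 1 2) := by
  have := congrArg (PowerSeries.map (liftUT (k := k) f hf : UT k 4 →+* 𝒜)) hΦ.pentagon
  simpa only [map_mul, map_eval, map_add, liftUT_tU] using this

theorem coeff_one_mul' {a b : PowerSeries 𝒜} : PowerSeries.coeff 1 (a * b) =
    PowerSeries.coeff 0 a * PowerSeries.coeff 1 b +
      PowerSeries.coeff 1 a * PowerSeries.coeff 0 b := by
  rw [PowerSeries.coeff_mul, Finset.Nat.antidiagonal_succ]
  simp

theorem coeff_zero_mul' {a b : PowerSeries 𝒜} : PowerSeries.coeff 0 (a * b) =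
    PowerSeries.coeff 0 a * PowerSeries.coeff 0 b := by
  rw [PowerSeries.coeff_mul, Finset.Nat.antidiagonal_zero, Finset.sum_singleton]

/-- An associator has no linear terms. -/
theorem IsAssociator.apply_of (hΦ : IsAssociator lam Φ) (i : Fin 2) : Φ (FreeMonoid.of i) = 0 := by
  have key : ∀ a b : k, Φ (FreeMonoid.of 0) * a + Φ (FreeMonoid.of 1) * b = 0 := by
    intro a b
    -- A scalar solution of the relations on four strands, with only `t₀₁ = a` and `t₂₃ = b`
    -- nonzero. The linear part of the pentagon then has `pa + qb` on the left and `2(pa + qb)` on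
    -- the right, where `p`, `q` are the linear coefficients of `Φ`.
    have hf : TFamily (fun i j : Fin 4 =>
        if (i = 0 ∧ j = 1) ∨ (i = 1 ∧ j = 0) then a else
          if (i = 2 ∧ j = 3) ∨ (i = 3 ∧ j = 2) then b else 0) :=
      { symm := fun i j => by fin_cases i <;> fin_cases j <;> rfl
        diag := fun i => by fin_cases i <;> rfl
        comm := fun _ _ _ _ _ => mul_comm _ _
        tri := fun _ _ _ => mul_comm _ _ }
    have := congrArg (PowerSeries.coeff 1) (hΦ.pentagon_of_tFamily hf)
    simp [coeff_one_mul', coeff_zero_mul', hΦ.coeff_zero, coeff_one_eval,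
      -PowerSeries.coeff_zero_eq_constantCoeff] at this
    linear_combination -this
  fin_cases i
  · simpa using key 1 0
  · simpa using key 0 1

theorem IsAssociator.coeff_one (hΦ : IsAssociator lam Φ) (x y : 𝒜) :
    PowerSeries.coeff 1 (eval Φ x y) = 0 := by
  rw [coeff_one_eval, hΦ.apply_of, hΦ.apply_of, zero_smul, zero_smul, add_zero]

/-- An associator is trivial on commuting elements. -/
theorem IsAssociator.eval_of_commute [CharZero k] (hΦ : IsAssociator lam Φ) {x y : 𝒜}
    (h : Commute x y) : eval Φ x y = 1 := by
  have key : ∀ m, 0 < m → PowerSeries.coeff m (eval Φ x y) = 0 := by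
    intro m
    induction m using Nat.strong_induction_on with
    | _ m ih =>
      intro hm
      rcases (Nat.succ_le_of_lt hm).eq_or_lt with rfl | hm1
      · exact hΦ.coeff_one x y
      -- Group-likeness gives `Φ(2x, 2y) = Φ(x, y)²`. In degree `m ≥ 2`, the products of lower
      -- coefficients vanish by induction, leaving `2^m a = 2a`.
      have h2 := congrArg (PowerSeries.coeff m)
        (hΦ.eval_add (Commute.refl x) h h.symm (Commute.refl y))
      obtain ⟨l, rfl⟩ : ∃ l, m = l + 1 := ⟨m - 1, by omega⟩
      rw [coeff_eval_add_self, PowerSeries.coeff_mul, Finset.Nat.sum_antidiagonal_succ,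
        hΦ.coeff_zero, one_mul] at h2
      obtain ⟨l, rfl⟩ : ∃ l', l = l' + 1 := ⟨l - 1, by omega⟩
      rw [Finset.Nat.sum_antidiagonal_succ', hΦ.coeff_zero, mul_one, Finset.sum_eq_zero, add_zero,
        ← two_smul k, ← sub_eq_zero, ← sub_smul, smul_eq_zero] at h2
      · refine h2.resolve_left ?_
        rw [sub_eq_zero]
        norm_cast
        rw [pow_succ, pow_succ]
        have := Nat.one_le_two_pow (n := l)
        omega
      · intro p hp
        rw [Finset.HasAntidiagonal.mem_antidiagonal] at hp
        rw [ih (p.1 + 1) (by omega) (by omega), zero_mul]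
  ext m
  rcases Nat.eq_zero_or_pos m with rfl | hm
  · rw [hΦ.coeff_zero, PowerSeries.coeff_one, if_pos rfl]
  · rw [key m hm, PowerSeries.coeff_one, if_neg hm.ne']

/-- The hexagonal relation for three elements whose sum is central. -/
theorem IsAssociator.hexagon_of_commute [CharZero k] (hΦ : IsAssociator lam Φ) {x y z c : 𝒜}
    (hc : c = x + y + z) (hx : Commute c x) (hy : Commute c y) :
    expo lam x * eval Φ z x * expo lam z * eval Φ y z * expo lam y * eval Φ x y = expo lam c := by
  have h := congrArg (PowerSeries.map (FreeAlgebra.lift k ![x, y] : Free2 k →+* 𝒜)) hΦ.hexagon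
  simp only [map_mul, map_eval, map_expo, map_one, varA, varB, map_sub, map_neg,
    FreeAlgebra.lift_ι_apply, Matrix.cons_val_zero, Matrix.cons_val_one] at h
  have hz : Commute c z := by
    have : z = c - x - y := by rw [hc]; abel
    rw [this]
    exact ((Commute.refl c).sub_right hx).sub_right hy
  -- The universal variable `C` becomes `z - c`. The shift by `c` is invisible to `Φ`, because a
  -- pair consisting of `-c` and `0` contributes a trivial factor, and it splits off from the
  -- exponential.
  have e : -x - y = z + -c := by rw [hc]; abel
  have e1 : eval Φ (-x - y) x = eval Φ z x := by
    have := hΦ.eval_add (x₁ := z) (y₁ := x) (x₂ := -c) (y₂ := 0) hz.symm.neg_right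
      (Commute.zero_right _) hx.symm.neg_right (Commute.zero_right _)
    rw [add_zero, hΦ.eval_of_commute (Commute.zero_right (-c)), mul_one] at this
    rw [e, this]
  have e2 : eval Φ y (-x - y) = eval Φ y z := by
    have := hΦ.eval_add (x₁ := y) (y₁ := z) (x₂ := 0) (y₂ := -c)
      (Commute.zero_right _) hy.symm.neg_right (Commute.zero_right _) hz.symm.neg_right
    rw [add_zero, hΦ.eval_of_commute (Commute.zero_left (-c)), mul_one] at this
    rw [e, this]
  rw [e1, e2, e, expo_add lam hz.symm.neg_right] at h
  have c1 : Commute (expo lam (-c)) (eval Φ y z) := commute_expo_eval _ _ hy.neg_left hz.neg_left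
  have c2 : Commute (expo lam (-c)) (expo lam y) := commute_expo_expo _ _ hy.neg_left
  have c3 : Commute (expo lam (-c)) (eval Φ x y) := commute_expo_eval _ _ hx.neg_left hy.neg_left
  have c4 := (c1.mul_right c2).mul_right c3
  have h' : expo lam x * eval Φ z x * expo lam z * eval Φ y z * expo lam y * eval Φ x y *
      expo lam (-c) = 1 := by
    rw [← h]
    simp only [mul_assoc] at c4 ⊢
    rw [c4.eq]
    simp only [mul_assoc]
  calc _ = expo lam x * eval Φ z x * expo lam z * eval Φ y z * expo lam y * eval Φ x y *
      (expo lam (-c) * expo lam c) := by rw [expo_neg_mul_expo, mul_one]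
    _ = expo lam c := by rw [← mul_assoc, h', one_mul]

/-- The last letter of a nonempty word acts first and kills `v`, so only the empty word contributes.
-/
theorem coeff_eval_apply_of_apply_eq_zero (Φ : NCSeries k) {V : Type*} [AddCommGroup V]
    [Module k V] {X Y : Module.End k V} {v : V} (hX : X v = 0) (hY : Y v = 0) (m : ℕ) :
    PowerSeries.coeff m (eval Φ X Y) v = if m = 0 then Φ 1 • v else 0 := by
  split_ifs with hm
  · subst hm
    rw [coeff_zero_eval]
    rfl
  · obtain ⟨m, rfl⟩ := Nat.exists_eq_succ_of_ne_zero hm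
    rw [coeff_eval, LinearMap.sum_apply]
    refine Finset.sum_eq_zero fun w _ => ?_
    rw [List.ofFn_succ' (fun i => ![X, Y] (w i)), List.concat_eq_append, List.prod_append,
      List.prod_singleton, LinearMap.smul_apply, Module.End.mul_apply]
    have h0 : (![X, Y] (w (Fin.last m))) v = 0 := by
      generalize w (Fin.last m) = j
      fin_cases j
      · exact hX
      · exact hY
    rw [h0, map_zero, smul_zero]

/-- The antipode of an associator is its inverse. -/
theorem IsAssociator.sum_coeff_mul_unop (hΦ : IsAssociator lam Φ) (x y : 𝒜) (m : ℕ) :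
    ∑ p ∈ Finset.HasAntidiagonal.antidiagonal m, PowerSeries.coeff p.1 (eval Φ x y) *
      (PowerSeries.coeff p.2 (eval Φ (MulOpposite.op (-x)) (MulOpposite.op (-y)))).unop =
    if m = 0 then 1 else 0 := by
  let iL : 𝒜 →ₐ[k] 𝒜 ⊗[k] 𝒜ᵐᵒᵖ := Algebra.TensorProduct.includeLeft
  let iR : 𝒜ᵐᵒᵖ →ₐ[k] 𝒜 ⊗[k] 𝒜ᵐᵒᵖ := Algebra.TensorProduct.includeRight
  have hcomm : ∀ a b, Commute (iL a) (iR b) := fun a b => by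
    simp [iL, iR, Commute, SemiconjBy]
  have h := hΦ.eval_add (hcomm x (MulOpposite.op (-x))) (hcomm x (MulOpposite.op (-y)))
    (hcomm y (MulOpposite.op (-x))) (hcomm y (MulOpposite.op (-y)))
  -- `𝒜 ⊗ 𝒜ᵐᵒᵖ` acts on `𝒜` by left and right multiplication. Left multiplication by `a` plus right
  -- multiplication by `-a` kills `1`, so `Φ` of such operators fixes `1`; expanding it by
  -- group-likeness gives the convolution identity.
  let F := AlgHom.mulLeftRight k 𝒜
  have h1 := congrArg (PowerSeries.coeff m) (congrArg (PowerSeries.map (F : _ →+* Module.End k 𝒜)) h)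
  rw [map_eval, ← map_eval iL, ← map_eval iR, PowerSeries.coeff_map] at h1
  have h2 := congrArg (fun f : Module.End k 𝒜 => f 1) h1
  have h3 : ∀ a : 𝒜, F (iL a + iR (MulOpposite.op (-a))) 1 = 0 := fun a => by
    simp [F, iL, iR]
  simp only [coeff_eval_apply_of_apply_eq_zero Φ (h3 x) (h3 y), hΦ.apply_one, one_smul,
    PowerSeries.coeff_mul, PowerSeries.coeff_map] at h2
  rw [h2]
  simp [F, iL, iR]

end GroupLike

/-! ### Braid relations from the hexagon and the pentagon -/

section Braid

theorem mul_mul_of_mul_eq {M : Type*} [Semigroup M] {a b c d : M} (h : a * b = c * d) (w : M) :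
    a * (b * w) = c * (d * w) := by
  rw [← mul_assoc, h, mul_assoc]

theorem mul_mul_of_mul_eq_one {M : Type*} [Monoid M] {a b : M} (h : a * b = 1) (w : M) :
    a * (b * w) = w := by
  rw [← mul_assoc, h, one_mul]

theorem semiconj_symm_of_sq {M : Type*} [Monoid M] {s x y : M} (hs : s * s = 1)
    (h : s * x = y * s) : s * y = x * s := by
  calc s * y = s * (y * s) * s := by rw [mul_assoc, mul_assoc, hs, mul_one]
    _ = x * s := by rw [← h, ← mul_assoc, hs, one_mul]

variable {k : Type*} [Field k] [CharZero k] {𝒜 : Type*} [Ring 𝒜] [Algebra k 𝒜]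
  {lam : k} {Φ : NCSeries k}

/-- The braid relation on three strands, from the hexagonal relation. -/
theorem IsAssociator.braid_three (hΦ : IsAssociator lam Φ) {x y z c s s' : 𝒜}
    (hc : c = x + y + z) (hcx : Commute c x) (hcy : Commute c y)
    (hs : s * s = 1) (hs' : s' * s' = 1) (hb : s * s' * s = s' * s * s')
    (hsx : s * x = x * s) (hsy : s * y = z * s) (hs'x : s' * x = z * s') (hs'y : s' * y = y * s') :
    (PowerSeries.C s * expo lam x) *
        (eval Φ y x * (PowerSeries.C s' * expo lam y) * eval Φ x y) *
        (PowerSeries.C s * expo lam x) =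
      (eval Φ y x * (PowerSeries.C s' * expo lam y) * eval Φ x y) *
        (PowerSeries.C s * expo lam x) *
        (eval Φ y x * (PowerSeries.C s' * expo lam y) * eval Φ x y) := by
  have hsz := semiconj_symm_of_sq hs hsy
  have hs'z := semiconj_symm_of_sq hs' hs'x
  have hcs : Commute s c := by
    change s * c = c * s
    rw [hc, mul_add, mul_add, add_mul, add_mul, hsx, hsy, hsz]
    abel
  have hcs' : Commute s' c := by
    change s' * c = c * s'
    rw [hc, mul_add, mul_add, add_mul, add_mul, hs'x, hs'y, hs'z]
    abel
  have H := hΦ.hexagon_of_commute hc hcx hcy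
  have cE : ∀ w, expo lam c * (PowerSeries.C s * (expo lam x * w)) =
      PowerSeries.C s * (expo lam x * (expo lam c * w)) := fun w => by
    rw [mul_mul_of_mul_eq (commute_C_expo lam hcs).eq.symm,
      mul_mul_of_mul_eq (commute_expo_expo lam lam hcx).eq]
  -- The hexagon solved for its last four factors; the trailing `w` makes it usable inside
  -- right-associated products.
  have H' : ∀ w, expo lam z * (eval Φ y z * (expo lam y * (eval Φ x y * w))) =
      eval Φ x z * (expo lam (-x) * (expo lam c * w)) := fun w => by
    rw [← H]
    simp only [mul_assoc]
    rw [mul_mul_of_mul_eq_one (expo_neg_mul_expo lam x),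
      mul_mul_of_mul_eq_one (hΦ.eval_mul_eval_swap x z)]
  have H1 := H' 1
  have cE1 := cE 1
  have bb : ∀ w, PowerSeries.C s * (PowerSeries.C s' * (PowerSeries.C s * w)) =
      PowerSeries.C s' * (PowerSeries.C s * (PowerSeries.C s' * w)) := fun w => by
    simp only [← mul_assoc, ← map_mul]
    rw [hb]
  simp only [mul_one] at H1 cE1
  -- Permutations are moved to the left and one hexagon is used on each side. Both sides then become
  -- `s s' s Φ(x, y) e^{λc}`, up to the braid relation between `s` and `s'`.
  have left : (PowerSeries.C s * expo lam x) *
        (eval Φ y x * (PowerSeries.C s' * expo lam y) * eval Φ x y) *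
        (PowerSeries.C s * expo lam x) = PowerSeries.C s * (PowerSeries.C s' * (PowerSeries.C s *
          (eval Φ x y * expo lam c))) := by
    simp only [mul_assoc]
    rw [mul_mul_of_mul_eq (C_mul_eval Φ hs'y hs'z).symm,
      mul_mul_of_mul_eq (C_mul_expo lam hs'z).symm, H', cE1,
      mul_mul_of_mul_eq (C_mul_expo lam (x := -x) (x' := -x) (by rw [mul_neg, hsx, neg_mul])).symm,
      mul_mul_of_mul_eq_one (expo_neg_mul_expo lam x), mul_mul_of_mul_eq (C_mul_eval Φ hsx hsy).symm]
  rw [left]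
  simp only [mul_assoc]
  rw [mul_mul_of_mul_eq (C_mul_eval Φ hs'y hs'z).symm (expo lam y * (eval Φ x y)),
    mul_mul_of_mul_eq (C_mul_expo lam hs'z).symm, H1,
    mul_mul_of_mul_eq (C_mul_eval Φ hsx hsz).symm, mul_mul_of_mul_eq (C_mul_eval Φ hs'z hs'x).symm,
    mul_mul_of_mul_eq (C_mul_expo lam hsz).symm, mul_mul_of_mul_eq (C_mul_expo lam hs'x).symm,
    mul_mul_of_mul_eq_one (hΦ.eval_mul_eval_swap z x),
    mul_mul_of_mul_eq_one (expo_mul_expo_neg lam x), bb,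
    mul_mul_of_mul_eq (C_mul_eval Φ hs'y hs'z).symm, mul_mul_of_mul_eq (C_mul_eval Φ hsz hsy).symm,
    mul_mul_of_mul_eq (C_mul_eval Φ hs'x hs'y).symm]

/-- Conjugation by an element `a` with inverse `b` transports the braid relation. -/
theorem braid_of_conj {M : Type*} [Monoid M] {a b x y : M} (hba : b * a = 1)
    (h : (a * x * b) * (a * y * b) * (a * x * b) =
      (a * y * b) * (a * x * b) * (a * y * b)) : x * y * x = y * x * y := by
  have h' := congrArg (fun u => b * u * a) h
  simpa only [mul_assoc, mul_mul_of_mul_eq_one hba, hba, mul_one] using h'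

/-- The braid relation on three strands next to a fixed bundle of strands. -/
theorem IsAssociator.braid_four (hΦ : IsAssociator lam Φ) {f : Fin 4 → Fin 4 → 𝒜} (hf : TFamily f)
    {s s' : 𝒜} (hs : s * s = 1) (hs' : s' * s' = 1) (hb : s * s' * s = s' * s * s')
    (h01 : s * f 0 1 = f 0 2 * s) (h12 : s * f 1 2 = f 1 2 * s)
    (h13 : s * f 1 3 = f 2 3 * s) (h01' : s' * f 0 1 = f 0 1 * s')
    (h12' : s' * f 1 2 = f 1 3 * s') (h23' : s' * f 2 3 = f 2 3 * s')
    (u v : PowerSeries 𝒜)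
    (hu : u = eval Φ (f 1 2) (f 0 1) * PowerSeries.C s * expo lam (f 1 2) * eval Φ (f 0 1) (f 1 2))
    (hv : v = eval Φ (f 2 3) (f 0 2 + f 1 2) * PowerSeries.C s' * expo lam (f 2 3) *
      eval Φ (f 0 2 + f 1 2) (f 2 3)) :
    u * v * u = v * u * v := by
  have pent := hΦ.pentagon_of_tFamily hf
  have inv := fun a b : 𝒜 => hΦ.eval_mul_eval_swap a b
  have inv' := fun (a b : 𝒜) w => mul_mul_of_mul_eq_one (inv a b) w
  -- The conjugating element is the right side of the pentagon without its first factor. This form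
  -- cancels the outer factors of `u`; the form `hF'`, obtained from the pentagon, cancels those of
  -- `v`. What is left of `F` in each case commutes with the permutation and the exponential in the
  -- middle.
  set F := eval Φ (f 0 1 + f 0 2) (f 1 3 + f 2 3) * eval Φ (f 0 1) (f 1 2) with hF
  set G := eval Φ (f 1 2) (f 0 1) * eval Φ (f 1 3 + f 2 3) (f 0 1 + f 0 2) with hG
  have hFG : F * G = 1 := by simp only [hF, hG, mul_assoc, inv', inv]
  have hGF : G * F = 1 := by simp only [hF, hG, mul_assoc, inv', inv]
  have hF' : F = eval Φ (f 2 3) (f 1 2) * eval Φ (f 0 1) (f 1 2 + f 1 3) *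
      eval Φ (f 0 2 + f 1 2) (f 2 3) := by
    rw [mul_assoc, pent, hF]; simp only [mul_assoc, inv']
  have hG' : G = eval Φ (f 2 3) (f 0 2 + f 1 2) * eval Φ (f 1 2 + f 1 3) (f 0 1) *
      eval Φ (f 1 2) (f 2 3) := by
    calc G = G * (F * (eval Φ (f 2 3) (f 0 2 + f 1 2) * eval Φ (f 1 2 + f 1 3) (f 0 1) *
        eval Φ (f 1 2) (f 2 3))) := by
          rw [hF']; simp only [mul_assoc, inv', inv, mul_one]
      _ = _ := by rw [← mul_assoc, hGF, one_mul]
  have hFu : F * u * G = PowerSeries.C s * expo lam (f 1 2) := by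
    have e1 : Commute (PowerSeries.C s) (eval Φ (f 0 1 + f 0 2) (f 1 3 + f 2 3)) := by
      apply commute_C_eval
      · have := semiconj_symm_of_sq hs h01
        change s * _ = _ * s
        rw [mul_add, add_mul, h01, this, add_comm]
      · have := semiconj_symm_of_sq hs h13
        change s * _ = _ * s
        rw [mul_add, add_mul, h13, this, add_comm]
    have e2 : Commute (expo lam (f 1 2)) (eval Φ (f 0 1 + f 0 2) (f 1 3 + f 2 3)) := by
      apply commute_expo_eval
      · have := hf.tri 1 2 0
        rwa [hf.symm 1 0, hf.symm 0 2, hf.symm 2 0] at this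
      · have := hf.tri 1 2 3
        rwa [hf.symm 3 2] at this
    rw [hu, hF, hG]
    simp only [mul_assoc, inv']
    rw [mul_mul_of_mul_eq e1.eq.symm, mul_mul_of_mul_eq e2.eq.symm, inv, mul_one]
  have hFv : F * v * G = eval Φ (f 2 3) (f 1 2) * (PowerSeries.C s' * expo lam (f 2 3)) *
      eval Φ (f 1 2) (f 2 3) := by
    have e1 : Commute (PowerSeries.C s') (eval Φ (f 0 1) (f 1 2 + f 1 3)) := by
      apply commute_C_eval
      · exact h01'
      · have := semiconj_symm_of_sq hs' h12'
        change s' * _ = _ * s'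
        rw [mul_add, add_mul, h12', this, add_comm]
    have e2 : Commute (expo lam (f 2 3)) (eval Φ (f 0 1) (f 1 2 + f 1 3)) := by
      apply commute_expo_eval
      · exact hf.comm 2 3 0 1 (by decide)
      · have := hf.tri 2 3 1
        rwa [hf.symm 2 1] at this
    rw [hv, hF', hG']
    simp only [mul_assoc, inv']
    rw [mul_mul_of_mul_eq e1.eq.symm, mul_mul_of_mul_eq e2.eq.symm, inv']
  apply braid_of_conj hGF
  rw [hFu, hFv]
  have h21 := semiconj_symm_of_sq hs h13
  -- Strand `0` has disappeared: only the three elements of strands `1`, `2`, `3` remain, and their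
  -- sum commutes with each of them by the relations `tri`.
  refine hΦ.braid_three (c := f 1 2 + f 2 3 + f 1 3) rfl ?_ ?_ hs hs' hb h12 h21 h12' h23'
  · have := hf.tri 1 2 3
    rw [hf.symm 3 2] at this
    have h2 : Commute (f 1 2) (f 1 3 + f 2 3) := this
    rw [add_assoc, add_comm (f 2 3)]
    exact (Commute.refl _).add_left h2.symm
  · have := hf.tri 2 3 1
    rw [hf.symm 2 1] at this
    have h2 : Commute (f 2 3) (f 1 2 + f 1 3) := this
    rw [add_right_comm]
    exact h2.symm.add_left (Commute.refl _)

end Braid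

/-! ### The braid relations for the Drinfeld elements -/

section DrinfeldElements

variable {k : Type*} [Field k] {n : ℕ}

variable (k) in
/-- The sum of the `t p q` for `p ∈ S` and `q ∈ T`. -/
noncomputable def blockT (S T : Finset (Fin n)) : InfBraidAlgebra k n :=
  ∑ p ∈ S, ∑ q ∈ T, t k p q

theorem commute_t_t {p q r l : Fin n} (h : [p, q, r, l].Nodup) : Commute (t k p q) (t k r l) :=
  (tFamily_t k).comm p q r l h

/-- The terms `l = p` and `l = q` together commute with `t p q` by the relation `tri`; every other
term involves four distinct strands. -/
theorem commute_t_sum {p q r : Fin n} {S : Finset (Fin n)} (hp : p ∈ S) (hq : q ∈ S) (hr : r ∉ S) :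
    Commute (t k p q) (∑ l ∈ S, t k l r) := by
  rcases eq_or_ne p q with rfl | hpq
  · rw [(tFamily_t k).diag]; exact Commute.zero_left _
  rw [← Finset.add_sum_erase _ _ hp, ← Finset.add_sum_erase _ _
    (Finset.mem_erase.2 ⟨hpq.symm, hq⟩ : q ∈ S.erase p), ← add_assoc]
  refine Commute.add_right ?_ (Commute.sum_right _ _ _ fun l hl => commute_t_t ?_)
  · have := (tFamily_t k).tri p q r
    rwa [(tFamily_t k).symm r q] at this
  · simp only [Finset.mem_erase] at hl
    have h1 : p ≠ r := fun h => hr (h ▸ hp)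
    have h2 : q ≠ r := fun h => hr (h ▸ hq)
    have h3 : l ≠ r := fun h => hr (h ▸ hl.2.2)
    simp [hpq, h1, h2, h3, hl.1.symm, hl.2.1.symm]

theorem commute_t_Y {p q r : Fin n} (hp : p < r) (hq : q < r) : Commute (t k p q) (Y k r) :=
  commute_t_sum (Finset.mem_Iio.2 hp) (Finset.mem_Iio.2 hq) (by simp)

theorem perm_mul_blockT (s : Equiv.Perm (Fin n)) (S T : Finset (Fin n)) :
    perm k s * blockT k S T =
      blockT k (S.map s.toEmbedding) (T.map s.toEmbedding) * perm k s := by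
  simp only [blockT, Finset.sum_map, Finset.mul_sum, Finset.sum_mul, perm_mul_t]
  rfl

theorem blockT_symm (S T : Finset (Fin n)) : blockT k S T = blockT k T S := by
  rw [blockT, blockT, Finset.sum_comm]
  exact Finset.sum_congr rfl fun _ _ => Finset.sum_congr rfl fun _ _ => (tFamily_t k).symm _ _

theorem Y_eq_blockT (r : Fin n) : Y k r = blockT k (Finset.Iio r) {r} := by
  simp [Y, blockT]

/-- Bundling disjoint sets of strands yields elements that satisfy the defining relations. -/
theorem tFamily_blockT {m : ℕ} {T : Fin m → Finset (Fin n)}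
    (hT : ∀ a b, a ≠ b → Disjoint (T a) (T b)) :
    TFamily fun a b => if a = b then 0 else blockT k (T a) (T b) where
  symm a b := by
    rcases eq_or_ne a b with rfl | h
    · rfl
    · rw [if_neg h, if_neg h.symm, blockT_symm]
  diag a := if_pos rfl
  comm a b c d h := by
    have hne : ∀ {a b p q}, a ≠ b → p ∈ T a → q ∈ T b → p ≠ q := fun {a b p q} hab hp hq e =>
      Finset.disjoint_left.1 (hT _ _ hab) hp (e ▸ hq)
    simp only [List.nodup_cons, List.mem_cons, not_or, List.not_mem_nil, or_false] at h
    obtain ⟨⟨h1, h2, h3⟩, ⟨h4, h5⟩, h6, -⟩ := h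
    rw [if_neg h1, if_neg h6]
    refine Commute.sum_left _ _ _ fun p hp => Commute.sum_left _ _ _ fun q hq =>
      Commute.sum_right _ _ _ fun r hr => Commute.sum_right _ _ _ fun l hl => commute_t_t ?_
    simp [hne h1 hp hq, hne h2 hp hr, hne h3 hp hl, hne h4 hq hr, hne h5 hq hl, hne h6 hr hl]
  tri a b c := by
    rcases eq_or_ne a b with rfl | hab
    · simp
    rcases eq_or_ne c a with rfl | hca
    · simp
    rcases eq_or_ne c b with rfl | hcb
    · simp
    rw [if_neg hab, if_neg hca.symm, if_neg hcb, blockT_symm (T c), blockT, blockT, blockT,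
      Finset.sum_comm (s := T a) (t := T c), Finset.sum_comm (s := T b) (t := T c),
      ← Finset.sum_add_distrib]
    refine Commute.sum_left _ _ _ fun p hp => Commute.sum_left _ _ _ fun q hq =>
      Commute.sum_right _ _ _ fun r hr => ?_
    -- For a fixed strand `r` of the third bundle, the two sums merge into one over the union of the
    -- first two bundles, which contains both `p` and `q`.
    rw [← Finset.sum_union (hT a b hab)]
    refine commute_t_sum (Finset.mem_union_left _ hp) (Finset.mem_union_right _ hq) ?_
    rw [Finset.mem_union, not_or]
    exact ⟨Finset.disjoint_left.1 (hT _ _ hca) hr, Finset.disjoint_left.1 (hT _ _ hcb) hr⟩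

theorem commute_eval_C_expo_eval {𝒜 : Type*} [Ring 𝒜] [Algebra k 𝒜] (lam : k) (Φ : NCSeries k)
    {x y s x' y' s' : 𝒜} (hxx : Commute x x') (hxy : Commute x y') (hxs : Commute x s')
    (hyx : Commute y x') (hyy : Commute y y') (hys : Commute y s')
    (hsx : Commute s x') (hsy : Commute s y') (hss : Commute s s') :
    Commute (eval Φ x y * PowerSeries.C s * expo lam x * eval Φ y x)
      (eval Φ x' y' * PowerSeries.C s' * expo lam x' * eval Φ y' x') := by
  refine ((Commute.mul_left ?_ ?_).mul_left ?_).mul_left ?_ <;>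
    refine ((Commute.mul_right ?_ ?_).mul_right ?_).mul_right ?_
  · exact commute_eval_eval Φ hxx hxy hyx hyy
  · exact (commute_C_eval Φ hxs.symm hys.symm).symm
  · exact (commute_expo_eval Φ lam hxx.symm hyx.symm).symm
  · exact commute_eval_eval Φ hxy hxx hyy hyx
  · exact commute_C_eval Φ hsx hsy
  · exact hss.map PowerSeries.C
  · exact commute_C_expo lam hsx
  · exact commute_C_eval Φ hsy hsx
  · exact commute_expo_eval Φ lam hxx hxy
  · exact (commute_C_expo lam hxs.symm).symm
  · exact commute_expo_expo _ _ hxx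
  · exact commute_expo_eval Φ lam hxy hxx
  · exact commute_eval_eval Φ hyx hyy hxx hxy
  · exact (commute_C_eval Φ hys.symm hxs.symm).symm
  · exact (commute_expo_eval Φ lam hyx.symm hxx.symm).symm
  · exact commute_eval_eval Φ hyy hyx hxy hxx

theorem map_swap_of_notMem {a b : Fin n} {S : Finset (Fin n)} (ha : a ∉ S) (hb : b ∉ S) :
    S.map (Equiv.swap a b).toEmbedding = S := by
  rw [Finset.map_eq_image]
  conv_rhs => rw [← Finset.image_id (s := S)]
  refine Finset.image_congr fun x hx => ?_
  exact Equiv.swap_apply_of_ne_of_ne (fun h => ha (h ▸ hx)) (fun h => hb (h ▸ hx))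

theorem map_swap_of_mem {a b : Fin n} {S : Finset (Fin n)} (ha : a ∈ S) (hb : b ∈ S) :
    S.map (Equiv.swap a b).toEmbedding = S := by
  refine Finset.eq_of_subset_of_card_le (fun x hx => ?_) (Finset.card_map _).ge
  obtain ⟨y, hy, rfl⟩ := Finset.mem_map.1 hx
  rw [Equiv.coe_toEmbedding, Equiv.swap_apply_def]
  split_ifs <;> assumption

theorem lo_lt_hi (i : Fin (n - 1)) : lo i < hi i := Nat.lt_succ_self _

/-- The ingredients for `i` live on strands below `lo j`. Those for `j` either avoid these strands
or, like `Y k (lo j)`, are symmetric in them and commute with the `t p q` supported there. -/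
theorem drinfeldElt_comm (lam : k) (Φ : NCSeries k) {i j : Fin (n - 1)} (hij : (i : ℕ) + 2 ≤ j) :
    Commute (drinfeldElt lam Φ i) (drinfeldElt lam Φ j) := by
  have h1 : lo i < hi i := lo_lt_hi i
  have h2 : hi i < lo j := by simp only [hi, lo, Fin.mk_lt_mk]; omega
  have h3 : lo j < hi j := lo_lt_hi j
  have h12 := h1.trans h2
  have h23 := h2.trans h3
  have h13 := h12.trans h3
  have fixj : ∀ p, p < lo j → Equiv.swap (lo j) (hi j) p = p := fun p hp =>
    Equiv.swap_apply_of_ne_of_ne hp.ne (hp.trans h3).ne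
  have perm_t : ∀ (s : Equiv.Perm (Fin n)) p q, s p = p → s q = q → Commute (perm k s) (t k p q) :=
    fun s p q hp hq => by
      change _ * _ = _ * _
      rw [perm_mul_t, hp, hq]
  have nd : ∀ p q r l : Fin n, p < q → q < r → r < l → [p, q, r, l].Nodup := by
    intro p q r l a b c
    simp [a.ne, b.ne, c.ne, (a.trans b).ne, (b.trans c).ne, ((a.trans b).trans c).ne]
  refine commute_eval_C_expo_eval lam Φ (commute_t_t (nd _ _ _ _ h1 h2 h3)) (commute_t_Y h12 h2)
    (perm_t _ _ _ (fixj _ h12) (fixj _ h2)).symm ?_ ?_ ?_ ?_ ?_ ?_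
  · exact Commute.sum_left _ _ _ fun l hl =>
      commute_t_t (nd _ _ _ _ (Finset.mem_Iio.1 hl) h12 h3)
  · exact Commute.sum_left _ _ _ fun l hl => commute_t_Y ((Finset.mem_Iio.1 hl).trans h12) h12
  · exact Commute.sum_left _ _ _ fun l hl =>
      (perm_t _ _ _ (fixj _ ((Finset.mem_Iio.1 hl).trans h12)) (fixj _ h12)).symm
  · exact perm_t _ _ _ (Equiv.swap_apply_of_ne_of_ne h12.ne' h2.ne')
      (Equiv.swap_apply_of_ne_of_ne h13.ne' h23.ne')
  · change _ * _ = _ * _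
    rw [Y_eq_blockT, perm_mul_blockT, map_swap_of_mem (Finset.mem_Iio.2 h12) (Finset.mem_Iio.2 h2),
      map_swap_of_notMem (by simpa using h12.ne) (by simpa using h2.ne)]
  · change _ * _ = _ * _
    rw [← perm_mul, ← perm_mul]
    congr 1
    refine (Equiv.Perm.disjoint_iff_disjoint_support.2 ?_).commute.eq
    rw [Equiv.Perm.support_swap h1.ne, Equiv.Perm.support_swap h3.ne]
    simp [h12.ne', h2.ne', h13.ne', h23.ne']

theorem perm_swap_mul_self (a b : Fin n) : perm k (Equiv.swap a b) * perm k (Equiv.swap a b) = 1 := by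
  rw [← perm_mul, Equiv.swap_mul_self, perm_one]

theorem drinfeldElt_braid [CharZero k] {lam : k} {Φ : NCSeries k} (hΦ : IsAssociator lam Φ)
    {i j : Fin (n - 1)} (hij : (i : ℕ) + 1 = j) :
    drinfeldElt lam Φ i * drinfeldElt lam Φ j * drinfeldElt lam Φ i =
      drinfeldElt lam Φ j * drinfeldElt lam Φ i * drinfeldElt lam Φ j := by
  have h1 : lo i < hi i := lo_lt_hi i
  have h2 : lo j = hi i := by simp [hi, lo, hij]
  have h3 : hi i < hi j := by rw [← h2]; exact lo_lt_hi j
  have h4 := h1.trans h3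
  -- The strands left of `lo i` act as one strand, possibly an empty one. With this bundling, `Y k
  -- (lo i)` is the element of bundles `0`, `1`, and `Y k (hi i)` is the sum of those of `0`, `2`
  -- and `1`, `2`.
  let T : Fin 4 → Finset (Fin n) := ![Finset.Iio (lo i), {lo i}, {hi i}, {hi j}]
  have hT : ∀ a b, a ≠ b → Disjoint (T a) (T b) := by
    intro a b hab
    fin_cases a <;> fin_cases b <;>
      simp [T, h1.ne, h1.ne', h3.ne, h3.ne', h4.ne, h4.ne', h1.le, h4.le] at hab ⊢
  have hY : Y k (hi i) = blockT k (T 0) (T 2) + blockT k (T 1) (T 2) := by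
    have : Finset.Iio (hi i) = insert (lo i) (Finset.Iio (lo i)) := by
      ext p
      simp only [Finset.mem_Iio, Finset.mem_insert, Fin.ext_iff, Fin.lt_def, hi, lo]
      omega
    rw [Y_eq_blockT, blockT, this, Finset.sum_insert (by simp), add_comm]
    simp [T, blockT]
  have b12 : blockT k (T 1) (T 2) = t k (lo i) (hi i) := by simp [T, blockT]
  have b23 : blockT k (T 2) (T 3) = t k (hi i) (hi j) := by simp [T, blockT]
  have b01 : blockT k (T 0) (T 1) = Y k (lo i) := by simp [T, blockT, Y]
  let s := Equiv.swap (lo i) (hi i)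
  let s' := Equiv.swap (hi i) (hi j)
  have s0 : (T 0).map s.toEmbedding = T 0 := map_swap_of_notMem (by simp [T]) (by simp [T, h1.le])
  have s1 : (T 1).map s.toEmbedding = T 2 := by simp [T, s]
  have s2 : (T 2).map s.toEmbedding = T 1 := by simp [T, s]
  have s3 : (T 3).map s.toEmbedding = T 3 :=
    map_swap_of_notMem (by simp [T, h4.ne]) (by simp [T, h3.ne])
  have s0' : (T 0).map s'.toEmbedding = T 0 :=
    map_swap_of_notMem (by simp [T, h1.le]) (by simp [T, h4.le])
  have s1' : (T 1).map s'.toEmbedding = T 1 :=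
    map_swap_of_notMem (by simp [T, h1.ne']) (by simp [T, h4.ne'])
  have s2' : (T 2).map s'.toEmbedding = T 3 := by simp [T, s']
  have s3' : (T 3).map s'.toEmbedding = T 2 := by simp [T, s']
  refine hΦ.braid_four (tFamily_blockT (k := k) hT) (s := perm k s) (s' := perm k s')
    (perm_swap_mul_self _ _) (perm_swap_mul_self _ _) ?_ ?_ ?_ ?_ ?_ ?_ ?_ _ _ ?_ ?_
  · simp only [← perm_mul]
    congr 1
    have e := Equiv.swap_mul_swap_mul_swap h3.ne' h4.ne'
    rw [Equiv.swap_comm (hi j) (hi i), Equiv.swap_comm (hi i) (lo i)] at e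
    rw [e, Equiv.swap_mul_swap_mul_swap h1.ne h4.ne, Equiv.swap_comm]
  · simp only [reduceIte, Fin.reduceEq]; rw [perm_mul_blockT, s0, s1]
  · simp only [reduceIte, Fin.reduceEq]; rw [perm_mul_blockT, s1, s2, blockT_symm]
  · simp only [reduceIte, Fin.reduceEq]; rw [perm_mul_blockT, s1, s3]
  · simp only [reduceIte, Fin.reduceEq]; rw [perm_mul_blockT, s0', s1']
  · simp only [reduceIte, Fin.reduceEq]; rw [perm_mul_blockT, s1', s2']
  · simp only [reduceIte, Fin.reduceEq]; rw [perm_mul_blockT, s2', s3', blockT_symm]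
  · simp only [reduceIte, Fin.reduceEq]
    rw [b12, b01]
    rfl
  · simp only [reduceIte, Fin.reduceEq]
    rw [← hY, b23, drinfeldElt, h2]

end DrinfeldElements

/-! ### Representations applied to power series -/

section SeriesRep

/-- The coefficientwise action of an algebra morphism on power series. -/
noncomputable abbrev mapSeries {k 𝒜 ℬ : Type*} [Field k] [Ring 𝒜] [Ring ℬ] [Algebra k 𝒜]
    [Algebra k ℬ] (f : 𝒜 →ₐ[k] ℬ) : PowerSeries 𝒜 →+* PowerSeries ℬ :=
  PowerSeries.map (f : 𝒜 →+* ℬ)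

variable {k : Type*} [Field k] {𝒜 : Type*} [Ring 𝒜] [Algebra k 𝒜]
  {ι κ : Type*} [Fintype ι] [DecidableEq ι] [Fintype κ] [DecidableEq κ]

/-- The representation of the algebra of power series over `𝒜` induced by a matrix representation
of `𝒜`. -/
noncomputable def seriesRep (ρ : 𝒜 →ₐ[k] Matrix ι ι k) :
    PowerSeries 𝒜 →+* Matrix ι ι (PowerSeries k) where
  toFun a := Matrix.of fun x y => PowerSeries.mk fun m => ρ (PowerSeries.coeff m a) x y
  map_one' := by
    ext x y m
    rcases eq_or_ne m 0 with rfl | hm <;> rcases eq_or_ne x y with rfl | hxy <;>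
      simp [PowerSeries.coeff_one, *]
  map_mul' a b := by
    ext x y m
    simp only [Matrix.of_apply, PowerSeries.coeff_mk, PowerSeries.coeff_mul, map_sum, map_mul,
      Matrix.sum_apply, Matrix.mul_apply]
    exact Finset.sum_comm
  map_zero' := by ext; simp
  map_add' a b := by ext; simp

theorem coeff_seriesRep (ρ : 𝒜 →ₐ[k] Matrix ι ι k) (a : PowerSeries 𝒜) (x y : ι) (m : ℕ) :
    PowerSeries.coeff m (seriesRep ρ a x y) = ρ (PowerSeries.coeff m a) x y :=
  PowerSeries.coeff_mk m fun m => ρ (PowerSeries.coeff m a) x y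

theorem extendRep_eq {n : ℕ} (ρ : InfBraidAlgebra k n →ₐ[k] Matrix ι ι k)
    (a : PowerSeries (InfBraidAlgebra k n)) : extendRep ρ a = seriesRep ρ a := rfl

end SeriesRep

/-! ### The universal morphism from the braid group, and existence of `Φ̂(ρ)` -/

section BraidSeries

theorem isPhiHatOver_of_sigma {k : Type*} [Field k] {n : ℕ} {lam : k} {Φ : NCSeries k}
    {ι : Type*} [Fintype ι] [DecidableEq ι] {A : Subalgebra k (PowerSeries k)}
    {ρ : InfBraidAlgebra k n →ₐ[k] Matrix ι ι k}
    {R : BraidGroup n →* Matrix ι ι A}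
    (h : ∀ i x y, (R (sigma i) x y : PowerSeries k) = seriesRep ρ (drinfeldElt lam Φ i) x y) :
    IsPhiHatOver A lam Φ ρ R := fun i => by
  ext1 x y
  exact h i x y

variable {k : Type*} [Field k] {n : ℕ}

/-- The inverse of `drinfeldElt`. -/
noncomputable def drinfeldInv (lam : k) (Φ : NCSeries k) (i : Fin (n - 1)) :
    PowerSeries (InfBraidAlgebra k n) :=
  eval Φ (t k (lo i) (hi i)) (Y k (lo i)) *
    expo lam (-t k (lo i) (hi i)) *
    PowerSeries.C (perm k (Equiv.swap (lo i) (hi i))) *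
    eval Φ (Y k (lo i)) (t k (lo i) (hi i))

variable {lam : k} {Φ : NCSeries k}

theorem C_perm_swap_mul_self (a b : Fin n) :
    PowerSeries.C (perm k (Equiv.swap a b)) * PowerSeries.C (perm k (Equiv.swap a b)) = 1 := by
  rw [← map_mul, perm_swap_mul_self, map_one]

theorem IsAssociator.eval_mul_eval_swap_mul {𝒜 : Type*} [Ring 𝒜] [Algebra k 𝒜]
    (hΦ : IsAssociator lam Φ) (x y : 𝒜) (w : PowerSeries 𝒜) :
    eval Φ x y * (eval Φ y x * w) = w :=
  mul_mul_of_mul_eq_one (hΦ.eval_mul_eval_swap x y) w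

variable [CharZero k]

theorem drinfeldElt_mul_drinfeldInv (hΦ : IsAssociator lam Φ) (i : Fin (n - 1)) :
    drinfeldElt lam Φ i * drinfeldInv lam Φ i = 1 := by
  simp only [drinfeldElt, drinfeldInv, mul_assoc,
    hΦ.eval_mul_eval_swap_mul,
    mul_mul_of_mul_eq_one (expo_mul_expo_neg lam (t k (lo i) (hi i))),
    mul_mul_of_mul_eq_one (C_perm_swap_mul_self (k := k) (lo i) (hi i)), hΦ.eval_mul_eval_swap]

theorem drinfeldInv_mul_drinfeldElt (hΦ : IsAssociator lam Φ) (i : Fin (n - 1)) :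
    drinfeldInv lam Φ i * drinfeldElt lam Φ i = 1 := by
  simp only [drinfeldElt, drinfeldInv, mul_assoc,
    hΦ.eval_mul_eval_swap_mul,
    mul_mul_of_mul_eq_one (expo_neg_mul_expo lam (t k (lo i) (hi i))),
    mul_mul_of_mul_eq_one (C_perm_swap_mul_self (k := k) (lo i) (hi i)), hΦ.eval_mul_eval_swap]

/-- The element `drinfeldElt`, as a unit. -/
noncomputable def drinfeldUnit (hΦ : IsAssociator lam Φ) (i : Fin (n - 1)) :
    (PowerSeries (InfBraidAlgebra k n))ˣ :=
  ⟨drinfeldElt lam Φ i, drinfeldInv lam Φ i, drinfeldElt_mul_drinfeldInv hΦ i,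
    drinfeldInv_mul_drinfeldElt hΦ i⟩

/-- The morphism from the braid group to the units of the completion of `𝔅ₙ`. -/
noncomputable def braidUnits (n : ℕ) (hΦ : IsAssociator lam Φ) :
    BraidGroup n →* (PowerSeries (InfBraidAlgebra k n))ˣ :=
  PresentedGroup.toGroup (f := drinfeldUnit hΦ) (by
    rintro r (⟨i, j, hij, rfl⟩ | ⟨i, j, hij, rfl⟩)
    · rw [map_mul, map_inv, mul_inv_eq_one]
      simp only [map_mul, FreeGroup.lift_apply_of]
      exact Units.ext (drinfeldElt_braid hΦ hij)
    · rw [map_mul, map_inv, mul_inv_eq_one]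
      simp only [map_mul, FreeGroup.lift_apply_of]
      exact Units.ext (drinfeldElt_comm lam Φ hij).eq)

theorem braidUnits_sigma (hΦ : IsAssociator lam Φ) (i : Fin (n - 1)) :
    braidUnits n hΦ (sigma i) = drinfeldUnit hΦ i := PresentedGroup.toGroup.of _

/-- The morphism from the braid group to the completion of `𝔅ₙ`. -/
noncomputable def braidSeries (n : ℕ) (hΦ : IsAssociator lam Φ) :
    BraidGroup n →* PowerSeries (InfBraidAlgebra k n) :=
  (Units.coeHom _).comp (braidUnits n hΦ)

theorem braidSeries_sigma (hΦ : IsAssociator lam Φ) (i : Fin (n - 1)) :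
    braidSeries n hΦ (sigma i) = drinfeldElt lam Φ i := by
  simp [braidSeries, braidUnits_sigma, drinfeldUnit]

theorem braidSeries_sigma_inv (hΦ : IsAssociator lam Φ) (i : Fin (n - 1)) :
    braidSeries n hΦ (sigma i)⁻¹ = drinfeldInv lam Φ i := by
  simp [braidSeries, braidUnits_sigma, drinfeldUnit]

/-- A morphism from a group to a monoid lands in the units, where the universal property of the
presentation applies. -/
theorem braidGroup_hom_ext {M : Type*} [Monoid M] {f g : BraidGroup n →* M}
    (h : ∀ i, f (sigma i) = g (sigma i)) : f = g := by
  have : f.toHomUnits = g.toHomUnits := PresentedGroup.ext fun i => Units.ext (h i)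
  ext x
  exact congrArg Units.val (DFunLike.congr_fun this x)

variable {ι κ : Type*} [Fintype ι] [DecidableEq ι] [Fintype κ] [DecidableEq κ]

/-- Factoring through `braidSeries` describes the action of every braid, not only of the generators,
by one series independent of `ρ`. -/
theorem isPhiHat_iff (hΦ : IsAssociator lam Φ) (ρ : InfBraidAlgebra k n →ₐ[k] Matrix ι ι k)
    (R : BraidGroup n →* Matrix ι ι (PowerSeries k)) :
    IsPhiHat lam Φ ρ R ↔ R = ((seriesRep ρ : _ →* _).comp (braidSeries n hΦ)) := by
  constructor
  · intro h
    refine braidGroup_hom_ext fun i => ?_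
    rw [h i, extendRep_eq, MonoidHom.comp_apply, braidSeries_sigma]
    rfl
  · rintro rfl i
    rw [extendRep_eq, MonoidHom.comp_apply, braidSeries_sigma]
    rfl

theorem existsUnique_isPhiHat (hΦ : IsAssociator lam Φ)
    (ρ : InfBraidAlgebra k n →ₐ[k] Matrix ι ι k) :
    ∃! R : BraidGroup n →* Matrix ι ι (PowerSeries k), IsPhiHat lam Φ ρ R :=
  ⟨_, (isPhiHat_iff hΦ ρ _).2 rfl, fun _ hR => (isPhiHat_iff hΦ ρ _).1 hR⟩

variable {A : Subalgebra k (PowerSeries k)}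

theorem isPhiHatOver_iff (hΦ : IsAssociator lam Φ) (ρ : InfBraidAlgebra k n →ₐ[k] Matrix ι ι k)
    (R : BraidGroup n →* Matrix ι ι A) :
    IsPhiHatOver A lam Φ ρ R ↔
      ∀ g x y, (R g x y : PowerSeries k) = seriesRep ρ (braidSeries n hΦ g) x y := by
  rw [IsPhiHatOver, isPhiHat_iff hΦ, DFunLike.ext_iff]
  refine forall_congr' fun g => ?_
  rw [← Matrix.ext_iff]
  rfl

theorem existsUnique_isPhiHatOver (hΦ : IsAssociator lam Φ)
    (hA : ∀ (N : ℕ), 0 < N → ∀ (ρ : InfBraidAlgebra k n →ₐ[k] Matrix (Fin N) (Fin N) k)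
      (R : BraidGroup n →* Matrix (Fin N) (Fin N) (PowerSeries k)),
      IsPhiHat lam Φ ρ R → ∀ g x y, R g x y ∈ A)
    (ρ : InfBraidAlgebra k n →ₐ[k] Matrix ι ι k) :
    ∃! R : BraidGroup n →* Matrix ι ι A, IsPhiHatOver A lam Φ ρ R := by
  have mem : ∀ g x y, seriesRep ρ (braidSeries n hΦ g) x y ∈ A := by
    intro g x y
    -- The hypothesis on `A` concerns matrices indexed by `Fin N` with `N > 0`; the representation
    -- is reindexed, and the index `x` at hand shows that `N > 0`.
    let e := Fintype.equivFin ι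
    let ρ' := (Matrix.reindexAlgEquiv k k e).toAlgHom.comp ρ
    have := hA _ (Fintype.card_pos_iff.2 ⟨x⟩) ρ' _ ((isPhiHat_iff hΦ ρ' _).2 rfl) g (e x) (e y)
    convert this
    ext m
    rw [coeff_seriesRep]
    refine Eq.trans ?_ (coeff_seriesRep _ _ _ _ _).symm
    simp
  let R : BraidGroup n →* Matrix ι ι A :=
    { toFun g := Matrix.of fun x y => ⟨_, mem g x y⟩
      map_one' := by
        ext1 x y
        apply Subtype.ext
        simp only [map_one, Matrix.of_apply]
        rcases eq_or_ne x y with rfl | hxy <;> simp [*]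
      map_mul' g g' := by
        ext1 x y
        apply Subtype.ext
        simp [Matrix.mul_apply] }
  refine ⟨R, (isPhiHatOver_iff hΦ ρ R).2 fun _ _ _ => rfl, fun R' hR' => ?_⟩
  exact MonoidHom.ext fun g => Matrix.ext fun x y => Subtype.ext ((isPhiHatOver_iff hΦ ρ R').1 hR' g x y)

theorem IsPhiHatOver.dsum {ρ₁ : InfBraidAlgebra k n →ₐ[k] Matrix ι ι k}
    {ρ₂ : InfBraidAlgebra k n →ₐ[k] Matrix κ κ k} {R₁ : BraidGroup n →* Matrix ι ι A}
    {R₂ : BraidGroup n →* Matrix κ κ A} (hΦ : IsAssociator lam Φ)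
    (h₁ : IsPhiHatOver A lam Φ ρ₁ R₁) (h₂ : IsPhiHatOver A lam Φ ρ₂ R₂) :
    IsPhiHatOver A lam Φ (dsumAlg ρ₁ ρ₂) (dsumGrp R₁ R₂) := by
  rw [isPhiHatOver_iff hΦ] at *
  intro g x y
  rcases x with x | x <;> rcases y with y | y
  · exact (h₁ g x y).trans rfl
  · rfl
  · rfl
  · exact (h₂ g x y).trans rfl

end BraidSeries

/-! ### Group-likeness and tensor products -/

section Tensor

variable {k : Type*} [Field k] {n : ℕ}

theorem comul_t (i j : Fin n) : comul k n (t k i j) =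
    t k i j ⊗ₜ[k] (1 : InfBraidAlgebra k n) + (1 : InfBraidAlgebra k n) ⊗ₜ[k] t k i j :=
  liftB_t _ _ _ _ _ _

theorem comul_perm (s : Equiv.Perm (Fin n)) : comul k n (perm k s) = perm k s ⊗ₜ[k] perm k s :=
  liftB_perm _ _ _ _ _

theorem comul_Y (r : Fin n) : comul k n (Y k r) =
    Y k r ⊗ₜ[k] (1 : InfBraidAlgebra k n) + (1 : InfBraidAlgebra k n) ⊗ₜ[k] Y k r := by
  simp only [Y, map_sum, comul_t, Finset.sum_add_distrib, TensorProduct.sum_tmul,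
    TensorProduct.tmul_sum]

variable (k n) in
/-- The inclusion of the first tensor factor. -/
noncomputable def inclL : InfBraidAlgebra k n →ₐ[k] InfBraidAlgebra k n ⊗[k] InfBraidAlgebra k n :=
  Algebra.TensorProduct.includeLeft

variable (k n) in
/-- The inclusion of the second tensor factor. -/
noncomputable def inclR : InfBraidAlgebra k n →ₐ[k] InfBraidAlgebra k n ⊗[k] InfBraidAlgebra k n :=
  Algebra.TensorProduct.includeRight

theorem commute_inclL_inclR (a b : InfBraidAlgebra k n) : Commute (inclL k n a) (inclR k n b) := by
  simp [inclL, inclR, Commute, SemiconjBy]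

/-- The group-like power series. -/
def IsGroupLike (a : PowerSeries (InfBraidAlgebra k n)) : Prop :=
  mapSeries (comul k n) a =
    mapSeries (inclL k n) a * mapSeries (inclR k n) a

theorem IsGroupLike.mul {a b : PowerSeries (InfBraidAlgebra k n)} (ha : IsGroupLike a)
    (hb : IsGroupLike b) : IsGroupLike (a * b) := by
  have : Commute (mapSeries (inclR k n) a)
      (mapSeries (inclL k n) b) := commute_of_coeff fun i j => by
    rw [PowerSeries.coeff_map, PowerSeries.coeff_map]
    exact (commute_inclL_inclR _ _).symm
  rw [IsGroupLike] at *
  rw [map_mul, map_mul, map_mul, ha, hb, mul_assoc, mul_assoc, mul_mul_of_mul_eq this.eq]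

variable [CharZero k] {lam : k} {Φ : NCSeries k}

/-- Each of the four factors is group-like: those with `Φ` and the exponential because their
arguments are primitive, the permutation by definition of `comul`. -/
theorem isGroupLike_drinfeldElt (hΦ : IsAssociator lam Φ) (i : Fin (n - 1)) :
    IsGroupLike (drinfeldElt lam Φ i) := by
  have h1 : ∀ x y, comul k n x = inclL k n x + inclR k n x →
      comul k n y = inclL k n y + inclR k n y → IsGroupLike (eval Φ x y) := by
    intro x y hx hy
    rw [IsGroupLike, map_eval, map_eval, map_eval, hx, hy]
    exact hΦ.eval_add (commute_inclL_inclR _ _) (commute_inclL_inclR _ _) (commute_inclL_inclR _ _)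
      (commute_inclL_inclR _ _)
  refine (((h1 _ _ (comul_t _ _) (comul_Y _)).mul ?_).mul ?_).mul
    (h1 _ _ (comul_Y _) (comul_t _ _))
  · rw [IsGroupLike, PowerSeries.map_C, PowerSeries.map_C, PowerSeries.map_C, ← map_mul]
    congr 1
    refine (comul_perm _).trans ?_
    simp [inclL, inclR]
  · rw [IsGroupLike, map_expo, map_expo, map_expo, ← expo_add lam (commute_inclL_inclR _ _)]
    congr 1
    exact comul_t _ _

variable {ι κ : Type*} [Fintype ι] [DecidableEq ι] [Fintype κ] [DecidableEq κ]
  {A : Subalgebra k (PowerSeries k)}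

/-- Group-likeness of `d` turns its action on the tensor product into `(ρ₁(d) ⊗ 1)(1 ⊗ ρ₂(d))`; it
suffices to see this for the generators. -/
theorem IsPhiHatOver.tensor {ρ₁ : InfBraidAlgebra k n →ₐ[k] Matrix ι ι k}
    {ρ₂ : InfBraidAlgebra k n →ₐ[k] Matrix κ κ k} {R₁ : BraidGroup n →* Matrix ι ι A}
    {R₂ : BraidGroup n →* Matrix κ κ A} (hΦ : IsAssociator lam Φ)
    (h₁ : IsPhiHatOver A lam Φ ρ₁ R₁) (h₂ : IsPhiHatOver A lam Φ ρ₂ R₂) :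
    IsPhiHatOver A lam Φ (tensorAlg ρ₁ ρ₂) (tensorGrp R₁ R₂) := by
  rw [isPhiHatOver_iff hΦ] at h₁ h₂
  apply isPhiHatOver_of_sigma
  intro i x y
  set d := drinfeldElt lam Φ i with hd
  let τ := (Matrix.kroneckerAlgEquiv ι κ k).toAlgHom.comp (Algebra.TensorProduct.map ρ₁ ρ₂)
  have e1 : seriesRep (tensorAlg ρ₁ ρ₂) d =
      seriesRep τ (mapSeries (comul k n) d) := by
    ext x y m
    rw [coeff_seriesRep, coeff_seriesRep, PowerSeries.coeff_map]
    rfl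
  have e2 : seriesRep τ (mapSeries (inclL k n) d) =
      Matrix.kronecker (seriesRep ρ₁ d) 1 := by
    ext x y m
    rw [coeff_seriesRep, PowerSeries.coeff_map]
    simp only [τ, inclL, Matrix.kronecker, Matrix.kroneckerMap_apply]
    rcases eq_or_ne x.2 y.2 with h | h <;> simp [h, coeff_seriesRep, Matrix.one_apply]
  have e3 : seriesRep τ (mapSeries (inclR k n) d) =
      Matrix.kronecker 1 (seriesRep ρ₂ d) := by
    ext x y m
    rw [coeff_seriesRep, PowerSeries.coeff_map]
    simp only [τ, inclR, Matrix.kronecker, Matrix.kroneckerMap_apply]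
    rcases eq_or_ne x.1 y.1 with h | h <;> simp [h, coeff_seriesRep, Matrix.one_apply]
  rw [e1, show mapSeries (comul k n) d = _ from isGroupLike_drinfeldElt hΦ i, map_mul, e2, e3, Matrix.kronecker,
    ← Matrix.mul_kronecker_mul, mul_one, one_mul, hd, ← braidSeries_sigma hΦ,
    Matrix.kroneckerMap_apply, ← h₁, ← h₂]
  rfl

end Tensor

/-! ### The antipode and dual representations -/

section Dual

variable {k : Type*} [Field k] {𝒜 : Type*} [Ring 𝒜] [Algebra k 𝒜] {n : ℕ}

/-- The power series over the opposite algebra with the same coefficients. -/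
noncomputable def opSeries (a : PowerSeries 𝒜) : PowerSeries 𝒜ᵐᵒᵖ :=
  PowerSeries.mk fun m => MulOpposite.op (PowerSeries.coeff m a)

theorem opSeries_mul (a b : PowerSeries 𝒜) : opSeries (a * b) = opSeries b * opSeries a := by
  ext m
  rw [PowerSeries.coeff_mul, opSeries, PowerSeries.coeff_mk, PowerSeries.coeff_mul,
    ← Finset.Nat.sum_antidiagonal_swap, Finset.op_sum]
  simp [opSeries]

theorem opSeries_C (s : 𝒜) : opSeries (PowerSeries.C s) = PowerSeries.C (MulOpposite.op s) := by
  ext m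
  rw [opSeries, PowerSeries.coeff_mk, PowerSeries.coeff_C, PowerSeries.coeff_C]
  split_ifs <;> rfl

theorem opSeries_expo (c : k) (x : 𝒜) : opSeries (expo c x) = expo c (MulOpposite.op x) := by
  ext m
  rw [opSeries, PowerSeries.coeff_mk, coeff_expo, coeff_expo]
  rfl

variable {lam : k} {Φ : NCSeries k}

/-- The antipode applied to `Φ(x, y)` is a right inverse of it by `IsAssociator.sum_coeff_mul_unop`,
hence equals its two-sided inverse `Φ(y, x)`. -/
theorem IsAssociator.opSeries_eval (hΦ : IsAssociator lam Φ) (x y : 𝒜) :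
    opSeries (eval Φ y x) = eval Φ (MulOpposite.op (-x)) (MulOpposite.op (-y)) := by
  let U : PowerSeries 𝒜 := PowerSeries.mk fun m =>
    (PowerSeries.coeff m (eval Φ (MulOpposite.op (-x)) (MulOpposite.op (-y)))).unop
  have hU : eval Φ x y * U = 1 := by
    ext m
    rw [PowerSeries.coeff_mul, PowerSeries.coeff_one, ← hΦ.sum_coeff_mul_unop x y m]
    simp [U]
  have hU' : U = eval Φ y x := by
    rw [← mul_one (eval Φ y x), ← hU, ← mul_assoc, hΦ.eval_mul_eval_swap, one_mul]
  rw [← hU']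
  ext m
  simp [opSeries, U]

theorem antipode_t (i j : Fin n) : antipode k n (t k i j) = MulOpposite.op (-t k i j) :=
  liftB_t _ _ _ _ _ _

theorem antipode_perm (s : Equiv.Perm (Fin n)) :
    antipode k n (perm k s) = MulOpposite.op (perm k s⁻¹) :=
  liftB_perm _ _ _ _ _

theorem antipode_Y (r : Fin n) : antipode k n (Y k r) = MulOpposite.op (-Y k r) := by
  simp only [Y, map_sum, antipode_t, ← Finset.sum_neg_distrib, Finset.op_sum]

/-- The antipode inverts each group-like factor, and passage to the opposite algebra reverses their
order. -/
theorem map_antipode_drinfeldElt (hΦ : IsAssociator lam Φ) (i : Fin (n - 1)) :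
    mapSeries (antipode k n) (drinfeldElt lam Φ i) =
      opSeries (drinfeldInv lam Φ i) := by
  rw [drinfeldElt, drinfeldInv, opSeries_mul, opSeries_mul, opSeries_mul, map_mul, map_mul, map_mul,
    map_eval, map_eval, map_expo, PowerSeries.map_C, opSeries_C, opSeries_expo, hΦ.opSeries_eval,
    hΦ.opSeries_eval]
  simp only [RingHom.coe_coe, antipode_t, antipode_perm, antipode_Y, Equiv.swap_inv, mul_assoc]

variable [CharZero k] {ι : Type*} [Fintype ι] [DecidableEq ι] {A : Subalgebra k (PowerSeries k)}

theorem IsPhiHatOver.dual {ρ : InfBraidAlgebra k n →ₐ[k] Matrix ι ι k}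
    {R : BraidGroup n →* Matrix ι ι A} (hΦ : IsAssociator lam Φ)
    (h : IsPhiHatOver A lam Φ ρ R) : IsPhiHatOver A lam Φ (dualAlg ρ) (dualGrp R) := by
  rw [isPhiHatOver_iff hΦ] at h
  apply isPhiHatOver_of_sigma
  intro i x y
  refine (h _ y x).trans ?_
  rw [braidSeries_sigma_inv]
  ext m
  have := congrArg (PowerSeries.coeff m) (map_antipode_drinfeldElt hΦ i)
  rw [PowerSeries.coeff_map, opSeries, PowerSeries.coeff_mk] at this
  rw [coeff_seriesRep, coeff_seriesRep, dualAlg]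
  change _ = (ρ (antipode k n (PowerSeries.coeff m (drinfeldElt lam Φ i))).unop) y x
  rw [show antipode k n _ = _ from this, MulOpposite.unop_op]

end Dual

/-! ### Generators of `𝔅ₙ` -/

section Generation

variable {k : Type*} [Field k] {n : ℕ}

theorem exists_perm_apply_eq {α : Type*} [DecidableEq α] {a b p q : α} (hab : a ≠ b)
    (hpq : p ≠ q) : ∃ s : Equiv.Perm α, s a = p ∧ s b = q := by
  refine ⟨Equiv.swap a p * Equiv.swap b (Equiv.swap a p q), ?_, ?_⟩
  · rw [Equiv.Perm.mul_apply, Equiv.swap_apply_of_ne_of_ne hab, Equiv.swap_apply_left]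
    intro h
    have := congrArg (Equiv.swap a p) h
    rw [Equiv.swap_apply_left, Equiv.swap_apply_self] at this
    exact hpq this
  · rw [Equiv.Perm.mul_apply, Equiv.swap_apply_left, Equiv.swap_apply_self]

/-- A subalgebra which contains the `tᵢⱼ` and the permutations is everything. -/
theorem subalgebra_eq_top {S : Subalgebra k (InfBraidAlgebra k n)} (ht : ∀ i j, t k i j ∈ S)
    (hs : ∀ s, perm k s ∈ S) : S = ⊤ := by
  let g : Equiv.Perm (Fin n) →* S :=
    { toFun := fun s => ⟨perm k s, hs s⟩
      map_one' := rfl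
      map_mul' := fun s s' => Subtype.ext (perm_mul k s s') }
  have hg : ∀ s i j, g s * ⟨t k i j, ht i j⟩ = ⟨t k (s i) (s j), ht _ _⟩ * g s :=
    fun s i j => Subtype.ext (perm_mul_t k s i j)
  -- The universal property maps `𝔅ₙ` into `S`, and by uniqueness the composite with the inclusion
  -- is the identity.
  let F : InfBraidAlgebra k n →ₐ[k] S := liftB (fun i j => ⟨t k i j, ht i j⟩)
    { symm := fun i j => Subtype.ext ((tFamily_t k).symm i j)
      diag := fun i => Subtype.ext ((tFamily_t k).diag i)
      comm := fun i j l m h => Subtype.ext ((tFamily_t k).comm i j l m h)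
      tri := fun i j l => Subtype.ext ((tFamily_t k).tri i j l) } g hg
  have hF : S.val.comp F = AlgHom.id k _ := by
    apply B_hom_ext
    · intro i j
      exact congrArg Subtype.val (liftB_t _ _ _ hg i j)
    · intro s
      exact congrArg Subtype.val (liftB_perm _ _ _ hg s)
  refine eq_top_iff.2 fun x _ => ?_
  rw [← show S.val (F x) = x from DFunLike.congr_fun hF x]
  exact (F x).2

/-- `𝔅ₙ` is generated by the `t_{i,i+1}` and the adjacent transpositions. -/
theorem subalgebra_eq_top_of_adjacent (hn : 2 ≤ n) {S : Subalgebra k (InfBraidAlgebra k n)}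
    (ht : ∀ i : Fin (n - 1), t k (lo i) (hi i) ∈ S)
    (hs : ∀ i : Fin (n - 1), perm k (Equiv.swap (lo i) (hi i)) ∈ S) : S = ⊤ := by
  have hs' : ∀ s, perm k s ∈ S := by
    let g : Equiv.Perm (Fin n) →* InfBraidAlgebra k n :=
      { toFun := perm k
        map_one' := rfl
        map_mul' := perm_mul k }
    obtain ⟨m, rfl⟩ : ∃ m, n = m + 1 := ⟨n - 1, by omega⟩
    have : S.toSubmonoid.comap g = ⊤ := by
      rw [eq_top_iff, ← Equiv.Perm.mclosure_swap_castSucc_succ, Submonoid.closure_le]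
      rintro _ ⟨i, rfl⟩
      exact hs i
    intro s
    have hmem : s ∈ S.toSubmonoid.comap g := by rw [this]; trivial
    exact hmem
  refine subalgebra_eq_top (fun p q => ?_) hs'
  rcases eq_or_ne p q with rfl | hpq
  · rw [(tFamily_t k).diag]
    exact S.zero_mem
  · let i : Fin (n - 1) := ⟨0, by omega⟩
    obtain ⟨s, h1, h2⟩ := exists_perm_apply_eq (lo_lt_hi i).ne hpq
    -- The symmetric group is transitive on pairs of distinct strands, so a single adjacent `t`
    -- yields all the others by conjugation.
    have h3 : t k p q = perm k s * t k (lo i) (hi i) * perm k s⁻¹ := by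
      rw [perm_mul_t, h1, h2, mul_assoc, ← perm_mul, mul_inv_cancel, perm_one, mul_one]
    rw [h3]
    exact S.mul_mem (S.mul_mem (hs' _) (ht i)) (hs' _)

end Generation

/-! ### Expansion of the generators to first order -/

section Leading

variable {k : Type*} [Field k] {n : ℕ} {lam : k} {Φ : NCSeries k}

theorem coeff_zero_drinfeldElt (hΦ : IsAssociator lam Φ) (i : Fin (n - 1)) :
    PowerSeries.coeff 0 (drinfeldElt lam Φ i) = perm k (Equiv.swap (lo i) (hi i)) := by
  simp only [drinfeldElt, coeff_zero_mul', hΦ.coeff_zero, coeff_expo, PowerSeries.coeff_C]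
  simp

/-- Since `Φ` has no linear term, only the exponential contributes in degree one. -/
theorem coeff_one_drinfeldElt (hΦ : IsAssociator lam Φ) (i : Fin (n - 1)) :
    PowerSeries.coeff 1 (drinfeldElt lam Φ i) =
      lam • (perm k (Equiv.swap (lo i) (hi i)) * t k (lo i) (hi i)) := by
  simp only [drinfeldElt, coeff_zero_mul', coeff_one_mul', hΦ.coeff_zero, hΦ.coeff_one, coeff_expo,
    PowerSeries.coeff_C]
  simp

theorem coeff_zero_drinfeldElt_sq (hΦ : IsAssociator lam Φ) (i : Fin (n - 1)) :
    PowerSeries.coeff 0 (drinfeldElt lam Φ i * drinfeldElt lam Φ i) = 1 := by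
  rw [coeff_zero_mul', coeff_zero_drinfeldElt hΦ, perm_swap_mul_self]

/-- Squaring removes the permutation from the constant term, so the first-order term isolates `t`;
the two cross terms agree because `sᵢ` commutes with `t_{i,i+1}`. -/
theorem coeff_one_drinfeldElt_sq (hΦ : IsAssociator lam Φ) (i : Fin (n - 1)) :
    PowerSeries.coeff 1 (drinfeldElt lam Φ i * drinfeldElt lam Φ i) =
      (2 * lam) • t k (lo i) (hi i) := by
  have h : perm k (Equiv.swap (lo i) (hi i)) * t k (lo i) (hi i) =
      t k (lo i) (hi i) * perm k (Equiv.swap (lo i) (hi i)) := by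
    rw [perm_mul_t, Equiv.swap_apply_left, Equiv.swap_apply_right, (tFamily_t k).symm]
  rw [coeff_one_mul', coeff_zero_drinfeldElt hΦ, coeff_one_drinfeldElt hΦ, mul_smul_comm,
    smul_mul_assoc, ← mul_assoc, perm_swap_mul_self, one_mul, h, mul_assoc, perm_swap_mul_self,
    mul_one, ← add_smul, two_mul]

end Leading

/-! ### Coefficients of matrices of power series -/

section MatCoeff

variable {k : Type*} [Field k] {ι κ μ : Type*}

/-- The coefficients of a matrix of power series. -/
noncomputable def matCoeff (m : ℕ) (F : Matrix κ ι (PowerSeries k)) : Matrix κ ι k :=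
  F.map (PowerSeries.coeff m)

theorem matCoeff_mul [Fintype ι] (F : Matrix κ ι (PowerSeries k)) (G : Matrix ι μ (PowerSeries k))
    (m : ℕ) : matCoeff m (F * G) =
      ∑ p ∈ Finset.HasAntidiagonal.antidiagonal m, matCoeff p.1 F * matCoeff p.2 G := by
  ext x y
  simp only [matCoeff, Matrix.map_apply, Matrix.mul_apply, map_sum, PowerSeries.coeff_mul,
    Matrix.sum_apply]
  exact Finset.sum_comm

theorem matCoeff_zero_mul [Fintype ι] (F : Matrix κ ι (PowerSeries k))
    (G : Matrix ι μ (PowerSeries k)) : matCoeff 0 (F * G) = matCoeff 0 F * matCoeff 0 G := by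
  rw [matCoeff_mul, Finset.Nat.antidiagonal_zero, Finset.sum_singleton]

theorem matCoeff_one_mul [Fintype ι] (F : Matrix κ ι (PowerSeries k))
    (G : Matrix ι μ (PowerSeries k)) : matCoeff 1 (F * G) =
      matCoeff 0 F * matCoeff 1 G + matCoeff 1 F * matCoeff 0 G := by
  rw [matCoeff_mul, Finset.Nat.antidiagonal_succ]
  simp

theorem matCoeff_ext {F G : Matrix κ ι (PowerSeries k)} (h : ∀ m, matCoeff m F = matCoeff m G) :
    F = G := by
  ext x y m
  exact congrFun (congrFun (h m) x) y

variable [Fintype ι] [DecidableEq ι] [Fintype κ] [DecidableEq κ] {𝒜 : Type*} [Ring 𝒜] [Algebra k 𝒜]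

theorem matCoeff_seriesRep (ρ : 𝒜 →ₐ[k] Matrix ι ι k) (a : PowerSeries 𝒜) (m : ℕ) :
    matCoeff m (seriesRep ρ a) = ρ (PowerSeries.coeff m a) := by
  ext x y
  exact coeff_seriesRep ρ a x y m

/-- The elements of an algebra that are intertwined by a given matrix. -/
def intertwinedSubalgebra (ρ₁ : 𝒜 →ₐ[k] Matrix ι ι k) (ρ₂ : 𝒜 →ₐ[k] Matrix κ κ k)
    (f : Matrix κ ι k) : Subalgebra k 𝒜 where
  carrier := {x | f * ρ₁ x = ρ₂ x * f}
  mul_mem' {a b} ha hb := by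
    change f * _ = _ * f
    rw [map_mul, map_mul, ← Matrix.mul_assoc, show f * ρ₁ a = _ from ha, Matrix.mul_assoc,
      show f * ρ₁ b = _ from hb, Matrix.mul_assoc]
  add_mem' {a b} ha hb := by
    change f * _ = _ * f
    rw [map_add, map_add, Matrix.mul_add, Matrix.add_mul, show f * ρ₁ a = _ from ha,
      show f * ρ₁ b = _ from hb]
  algebraMap_mem' c := by
    change f * _ = _ * f
    simp [Algebra.algebraMap_eq_smul_one]

theorem seriesRep_intertwine {ρ₁ : 𝒜 →ₐ[k] Matrix ι ι k} {ρ₂ : 𝒜 →ₐ[k] Matrix κ κ k}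
    {F : Matrix κ ι (PowerSeries k)} (hF : ∀ m x, matCoeff m F * ρ₁ x = ρ₂ x * matCoeff m F)
    (a : PowerSeries 𝒜) : F * seriesRep ρ₁ a = seriesRep ρ₂ a * F := by
  refine matCoeff_ext fun m => ?_
  rw [matCoeff_mul, matCoeff_mul, ← Finset.Nat.sum_antidiagonal_swap]
  refine Finset.sum_congr rfl fun p _ => ?_
  rw [matCoeff_seriesRep, matCoeff_seriesRep, hF]
  rfl

end MatCoeff

/-! ### Coefficients of braid intertwiners -/

section Reduction

variable {k : Type*} [Field k] [CharZero k] {n : ℕ} {lam : k} {Φ : NCSeries k}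
  {ι κ : Type*} [Fintype ι] [DecidableEq ι] [Fintype κ] [DecidableEq κ]

/-- Degree 0 of the relation for `σᵢ` gives `sᵢ`. Degree 1 of the relation for `σᵢ²` gives `2λ
t_{i,i+1}`, because the terms with the first coefficient of `F` meet the constant term `1` on both
sides and cancel. -/
theorem matCoeff_zero_intertwine (hn : 2 ≤ n) (hlam : lam ≠ 0) (hΦ : IsAssociator lam Φ)
    {ρ₁ : InfBraidAlgebra k n →ₐ[k] Matrix ι ι k} {ρ₂ : InfBraidAlgebra k n →ₐ[k] Matrix κ κ k}
    {F : Matrix κ ι (PowerSeries k)} (hF : ∀ i, F * seriesRep ρ₁ (drinfeldElt lam Φ i) =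
      seriesRep ρ₂ (drinfeldElt lam Φ i) * F) (x : InfBraidAlgebra k n) :
    matCoeff 0 F * ρ₁ x = ρ₂ x * matCoeff 0 F := by
  have h : intertwinedSubalgebra ρ₁ ρ₂ (matCoeff 0 F) = ⊤ := by
    refine subalgebra_eq_top_of_adjacent hn (fun i => ?_) fun i => ?_
    · have h2 : F * seriesRep ρ₁ (drinfeldElt lam Φ i * drinfeldElt lam Φ i) =
          seriesRep ρ₂ (drinfeldElt lam Φ i * drinfeldElt lam Φ i) * F := by
        rw [map_mul, map_mul, ← Matrix.mul_assoc, hF, Matrix.mul_assoc, hF, Matrix.mul_assoc]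
      have h3 := congrArg (matCoeff 1) h2
      rw [matCoeff_one_mul, matCoeff_one_mul] at h3
      simp only [matCoeff_seriesRep, coeff_zero_drinfeldElt_sq hΦ, coeff_one_drinfeldElt_sq hΦ,
        map_one, Matrix.mul_one, Matrix.one_mul, map_smul, Matrix.mul_smul, Matrix.smul_mul] at h3
      rw [add_comm, add_right_inj] at h3
      exact smul_right_injective _ (mul_ne_zero two_ne_zero hlam) h3
    · have h3 := congrArg (matCoeff 0) (hF i)
      rwa [matCoeff_zero_mul, matCoeff_zero_mul, matCoeff_seriesRep, matCoeff_seriesRep,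
        coeff_zero_drinfeldElt hΦ] at h3
  have hx : x ∈ intertwinedSubalgebra ρ₁ ρ₂ (matCoeff 0 F) := by rw [h]; trivial
  exact hx

theorem matCoeff_intertwine (hn : 2 ≤ n) (hlam : lam ≠ 0) (hΦ : IsAssociator lam Φ)
    {ρ₁ : InfBraidAlgebra k n →ₐ[k] Matrix ι ι k} {ρ₂ : InfBraidAlgebra k n →ₐ[k] Matrix κ κ k}
    (m : ℕ) : ∀ {F : Matrix κ ι (PowerSeries k)} (_ : ∀ i, F * seriesRep ρ₁ (drinfeldElt lam Φ i) =
      seriesRep ρ₂ (drinfeldElt lam Φ i) * F) (x : InfBraidAlgebra k n),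
    matCoeff m F * ρ₁ x = ρ₂ x * matCoeff m F := by
  induction m with
  | zero => exact fun hF x => matCoeff_zero_intertwine hn hlam hΦ hF x
  | succ m ih =>
    intro F hF x
    let F₀ : Matrix κ ι (PowerSeries k) := (matCoeff 0 F).map PowerSeries.C
    -- `F = F₀ + hF'` with `F₀` constant. `F₀` intertwines the actions of `𝔅ₙ`, hence those of all
    -- series, so `hF'` and then `F'` are again braid intertwiners; the induction hypothesis must
    -- therefore hold for every `F`.
    let F' : Matrix κ ι (PowerSeries k) :=
      Matrix.of fun x y => PowerSeries.mk fun p => PowerSeries.coeff (p + 1) (F x y)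
    have hFF : F = F₀ + (PowerSeries.X : PowerSeries k) • F' := by
      ext x y p
      rcases p with _ | p
      · simp [F₀, F', matCoeff]
      · simp [F₀, F', matCoeff, PowerSeries.coeff_succ_X_mul]
    have h0 : ∀ a, F₀ * seriesRep ρ₁ a = seriesRep ρ₂ a * F₀ := by
      refine fun a => seriesRep_intertwine (fun p x => ?_) a
      rcases p with _ | p
      · have : matCoeff 0 F₀ = matCoeff 0 F := by ext; simp [matCoeff, F₀]
        rw [this]
        exact matCoeff_zero_intertwine hn hlam hΦ hF x
      · have : matCoeff (p + 1) F₀ = 0 := by ext; simp [matCoeff, F₀]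
        rw [this, Matrix.zero_mul, Matrix.mul_zero]
    have h1 := ih (F := F') (fun i => by
      have := hF i
      rw [hFF, Matrix.add_mul, Matrix.mul_add, h0, add_right_inj, Matrix.smul_mul,
        Matrix.mul_smul] at this
      exact smul_right_injective _ PowerSeries.X_ne_zero this) x
    have h2 : matCoeff m F' = matCoeff (m + 1) F := by ext; simp [matCoeff, F']
    rwa [h2] at h1

end Reduction

/-! ### Intertwiners under extension of scalars -/

section BaseChange

variable {k : Type*} [Field k] {ι κ : Type*} [Fintype ι] [Fintype κ] {Γ : Type*} (M₁ : Γ → Matrix ι ι k) (M₂ : Γ → Matrix κ κ k)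
  (T : Type*) [CommRing T] [Algebra k T]

theorem intertwinersBaseChange_tmul (a : T) (f : intertwiners M₁ M₂) :
    intertwinersBaseChange M₁ M₂ T (a ⊗ₜ f) = a • (f : Matrix κ ι k).map (algebraMap k T) := rfl

/-- In a basis of `T` over `k`, a tensor is a finite family of intertwiners over `k`, which are the
coordinates of the image matrix. -/
theorem intertwinersBaseChange_injective :
    Function.Injective (intertwinersBaseChange M₁ M₂ T) := by
  classical
  rw [injective_iff_map_eq_zero]
  intro z hz
  let b := Module.Basis.ofVectorSpace k T
  obtain ⟨c, rfl⟩ := (TensorProduct.equivFinsuppOfBasisLeft (N := intertwiners M₁ M₂) b).symm.surjective z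
  suffices c = 0 by rw [this, map_zero]
  rw [TensorProduct.equivFinsuppOfBasisLeft_symm_apply, Finsupp.sum, map_sum] at hz
  ext i x y
  have h := congrArg (fun f => b.repr (f x y) i) hz
  simp only [intertwinersBaseChange_tmul, Matrix.sum_apply, Matrix.smul_apply, Matrix.map_apply,
    smul_eq_mul, map_sum, Matrix.zero_apply, map_zero, Finsupp.coe_zero, Pi.zero_apply,
    Finsupp.finsetSum_apply] at h
  simp_rw [mul_comm (b _), ← Algebra.smul_def, map_smul, b.repr_self] at h
  by_cases hi : i ∈ c.support
  · simpa [Finsupp.single_apply, Finset.sum_ite_eq, hi] using h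
  · rw [Finsupp.notMem_support_iff.1 hi]
    rfl

/-- The intertwining equations are linear with coefficients in `k`, so each coordinate matrix of a
solution over `T`, in a basis of `T` over `k`, is itself a solution. -/
theorem range_intertwinersBaseChange :
    LinearMap.range (intertwinersBaseChange M₁ M₂ T) =
      intertwiners (fun g => (M₁ g).map (algebraMap k T)) fun g => (M₂ g).map (algebraMap k T) := by
  apply le_antisymm
  · rintro _ ⟨z, rfl⟩
    induction z using TensorProduct.induction_on with
    | zero => rw [map_zero]; exact Submodule.zero_mem _
    | tmul a f =>
      rw [intertwinersBaseChange_tmul]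
      refine Submodule.smul_mem _ _ fun g => ?_
      rw [← Matrix.map_mul, ← Matrix.map_mul, f.2 g]
    | add u v hu hv => rw [map_add]; exact Submodule.add_mem _ hu hv
  · intro f hf
    let b := Module.Basis.ofVectorSpace k T
    let F := fun i => (f.map fun a => b.repr a i : Matrix κ ι k)
    have hF : ∀ i, F i ∈ intertwiners M₁ M₂ := by
      intro i g
      ext x y
      have h := congrArg (fun f => b.repr (f x y) i) (hf g)
      simp only [Matrix.mul_apply, Matrix.map_apply, map_sum, Finsupp.finsetSum_apply] at h
      simp_rw [mul_comm (f _ _), ← Algebra.smul_def, map_smul] at h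
      simpa [F, Matrix.mul_apply, mul_comm] using h
    classical
    -- The finitely many basis elements occurring in some entry of `f`.
    let s := Finset.univ.biUnion fun p : κ × ι => (b.repr (f p.1 p.2)).support
    refine ⟨∑ i ∈ s, b i ⊗ₜ ⟨F i, hF i⟩, ?_⟩
    rw [map_sum]
    ext x y
    simp only [intertwinersBaseChange_tmul, Matrix.sum_apply, Matrix.smul_apply, Matrix.map_apply, F,
      smul_eq_mul]
    simp_rw [mul_comm (b _), ← Algebra.smul_def]
    conv_rhs => rw [← b.linearCombination_repr (f x y), Finsupp.linearCombination_apply, Finsupp.sum]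
    refine (Finset.sum_subset (fun i hi => ?_) fun i _ hi => ?_).symm
    · exact Finset.mem_biUnion.2 ⟨(x, y), Finset.mem_univ _, hi⟩
    · rw [Finsupp.notMem_support_iff.1 hi, zero_smul]

variable {T}

/-- Clearing denominators of an intertwiner. -/
theorem mem_intertwiners_map_iff {A K : Type*} [CommRing A] [IsDomain A] [Field K] [Algebra A K]
    [IsFractionRing A K] {N₁ : Γ → Matrix ι ι A} {N₂ : Γ → Matrix κ κ A} {a : A} (ha : a ≠ 0)
    {f : Matrix κ ι K} {g : Matrix κ ι A} (hfg : algebraMap A K a • f = g.map (algebraMap A K)) :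
    (f ∈ intertwiners (fun x => (N₁ x).map (algebraMap A K))
      fun x => (N₂ x).map (algebraMap A K)) ↔ g ∈ intertwiners N₁ N₂ := by
  have ha' : algebraMap A K a ≠ 0 := by
    rwa [Ne, IsFractionRing.to_map_eq_zero_iff]
  have hinj : Function.Injective fun h : Matrix κ ι A => h.map (algebraMap A K) :=
    Matrix.map_injective (IsFractionRing.injective A K)
  refine forall_congr' fun x => ?_
  rw [← hinj.eq_iff, ← (smul_right_injective (Matrix κ ι K) ha').eq_iff]
  simp only [Matrix.map_mul]
  rw [← Matrix.smul_mul, ← Matrix.mul_smul, hfg]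

theorem exists_smul_eq_map {A K : Type*} [CommRing A] [IsDomain A] [Field K] [Algebra A K]
    [IsFractionRing A K] (f : Matrix κ ι K) :
    ∃ a : A, a ≠ 0 ∧ ∃ g : Matrix κ ι A, algebraMap A K a • f = g.map (algebraMap A K) := by
  obtain ⟨a, ha⟩ := IsLocalization.exist_integer_multiples_of_finite (nonZeroDivisors A)
    fun p : κ × ι => f p.1 p.2
  choose g hg using ha
  refine ⟨a, nonZeroDivisors.ne_zero a.2, Matrix.of fun x y => g (x, y), ?_⟩
  ext x y
  rw [Matrix.map_apply, Matrix.of_apply, hg (x, y), Matrix.smul_apply, algebraMap_smul]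

end BaseChange

/-! ### Matrices over `k`, `A` and `K` -/

section Scalars

variable {k : Type*} [Field k] {ι κ : Type*} {A : Subalgebra k (PowerSeries k)}

theorem map_val_injective : Function.Injective fun f : Matrix κ ι A => f.map A.val :=
  Matrix.map_injective Subtype.val_injective

theorem matCoeff_map_val_map {f : Matrix κ ι k} (m : ℕ) :
    matCoeff m ((f.map (algebraMap k A)).map A.val) = if m = 0 then f else 0 := by
  ext x y
  simp only [matCoeff, Matrix.map_apply, AlgHom.commutes, PowerSeries.algebraMap_apply,
    Algebra.algebraMap_self_apply, PowerSeries.coeff_C]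
  split_ifs <;> rfl

theorem map_algebraMap_map {K : Type*} [Field K] [Algebra k K] [Algebra A K] [IsScalarTower k A K]
    (M : Matrix κ ι k) :
    (M.map (algebraMap k A)).map (algebraMap A K) = M.map (algebraMap k K) := by
  ext x y
  exact (IsScalarTower.algebraMap_apply k A K _).symm

end Scalars

/-! ### Homomorphisms between the braid representations -/

section Intertwiners

variable {k : Type*} [Field k] {n : ℕ} {lam : k} {Φ : NCSeries k}
  {ι κ : Type*} [Fintype ι] [DecidableEq ι] [Fintype κ] [DecidableEq κ]
  {A : Subalgebra k (PowerSeries k)} {ρ₁ : InfBraidAlgebra k n →ₐ[k] Matrix ι ι k}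
  {ρ₂ : InfBraidAlgebra k n →ₐ[k] Matrix κ κ k} {R₁ : BraidGroup n →* Matrix ι ι A}
  {R₂ : BraidGroup n →* Matrix κ κ A}

/-- The matrices `ρ(x)` are concentrated in degree zero, so the equation decouples degree by degree.
-/
theorem mem_intertwiners_algebraMap_iff (f : Matrix κ ι A) :
    (f ∈ intertwiners (fun x => (ρ₁ x).map (algebraMap k A))
      fun x => (ρ₂ x).map (algebraMap k A)) ↔
      ∀ m x, matCoeff m (f.map A.val) * ρ₁ x = ρ₂ x * matCoeff m (f.map A.val) := by
  have e1 : ∀ m x, matCoeff m ((f * (ρ₁ x).map (algebraMap k A)).map A.val) =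
      matCoeff m (f.map A.val) * ρ₁ x := fun m x => by
    rw [Matrix.map_mul, matCoeff_mul, Finset.sum_eq_single (m, 0)]
    · rw [matCoeff_map_val_map, if_pos rfl]
    · rintro ⟨i, j⟩ hij h
      rw [Finset.HasAntidiagonal.mem_antidiagonal] at hij
      rw [matCoeff_map_val_map, if_neg, Matrix.mul_zero]
      rintro rfl
      exact h (by simpa using hij)
    · simp
  have e2 : ∀ m x, matCoeff m (((ρ₂ x).map (algebraMap k A) * f).map A.val) =
      ρ₂ x * matCoeff m (f.map A.val) := fun m x => by
    rw [Matrix.map_mul, matCoeff_mul, Finset.sum_eq_single (0, m)]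
    · rw [matCoeff_map_val_map, if_pos rfl]
    · rintro ⟨i, j⟩ hij h
      rw [Finset.HasAntidiagonal.mem_antidiagonal] at hij
      rw [matCoeff_map_val_map, if_neg, Matrix.zero_mul]
      rintro rfl
      exact h (by simpa using hij)
    · simp
  constructor
  · intro h m x
    rw [← e1, ← e2, h x]
  · intro h x
    apply map_val_injective
    refine matCoeff_ext fun m => ?_
    rw [e1, e2, h]

variable [CharZero k]

theorem IsPhiHatOver.map_val {ρ : InfBraidAlgebra k n →ₐ[k] Matrix ι ι k}
    {R : BraidGroup n →* Matrix ι ι A} (hΦ : IsAssociator lam Φ) (h : IsPhiHatOver A lam Φ ρ R)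
    (g : BraidGroup n) : (R g).map A.val = seriesRep ρ (braidSeries n hΦ g) := by
  ext1 x y
  exact (isPhiHatOver_iff hΦ ρ R).1 h g x y

/-- The central comparison: both sides say that every coefficient of `f` commutes with `𝔅ₙ`, one way
by `matCoeff_intertwine`, the other because braids act through series in `𝔅ₙ`. -/
theorem intertwiners_eq (hn : 2 ≤ n) (hlam : lam ≠ 0) (hΦ : IsAssociator lam Φ)
    (h₁ : IsPhiHatOver A lam Φ ρ₁ R₁) (h₂ : IsPhiHatOver A lam Φ ρ₂ R₂) :
    intertwiners R₁ R₂ = intertwiners (fun x => (ρ₁ x).map (algebraMap k A))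
      fun x => (ρ₂ x).map (algebraMap k A) := by
  ext f
  rw [mem_intertwiners_algebraMap_iff]
  have key : ∀ g, f * R₁ g = R₂ g * f ↔ f.map A.val * seriesRep ρ₁ (braidSeries n hΦ g) =
      seriesRep ρ₂ (braidSeries n hΦ g) * f.map A.val := fun g => by
    rw [← h₁.map_val hΦ, ← h₂.map_val hΦ, ← Matrix.map_mul, ← Matrix.map_mul,
      map_val_injective.eq_iff]
  constructor
  · intro hf m x
    refine matCoeff_intertwine hn hlam hΦ m (fun i => ?_) x
    have := (key (sigma i)).1 (hf _)
    rwa [braidSeries_sigma] at this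
  · exact fun hf g => (key g).2 (seriesRep_intertwine hf _)

variable {K : Type*} [Field K] [Algebra k K] [Algebra A K] [IsScalarTower k A K]
  [IsFractionRing A K]

theorem intertwiners_fraction_eq (hn : 2 ≤ n) (hlam : lam ≠ 0) (hΦ : IsAssociator lam Φ)
    (h₁ : IsPhiHatOver A lam Φ ρ₁ R₁) (h₂ : IsPhiHatOver A lam Φ ρ₂ R₂) :
    intertwiners (mapRep (algebraMap A K) R₁) (mapRep (algebraMap A K) R₂) =
      intertwiners (fun x => (ρ₁ x).map (algebraMap k K)) fun x => (ρ₂ x).map (algebraMap k K) := by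
  ext f
  obtain ⟨a, ha, g, hfg⟩ := exists_smul_eq_map (A := A) f
  refine (mem_intertwiners_map_iff (N₁ := R₁) (N₂ := R₂) ha hfg).trans ?_
  rw [intertwiners_eq hn hlam hΦ h₁ h₂, ← mem_intertwiners_map_iff ha hfg]
  simp only [map_algebraMap_map]

end Intertwiners

/-! ### Indecomposability and idempotents -/

section Families

variable {ι κ : Type*} [Fintype ι] [DecidableEq ι] {S : Type*} [CommRing S] {Γ : Type*}

/-- The matrix of the projection with given image and kernel. -/
theorem exists_projection_matrix {W₁ W₂ : Submodule S (ι → S)} (h : IsCompl W₁ W₂) :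
    ∃ e : Matrix ι ι S, (∀ v ∈ W₁, e.mulVec v = v) ∧ (∀ v ∈ W₂, e.mulVec v = 0) ∧
      ∀ v, e.mulVec v ∈ W₁ := by
  refine ⟨LinearMap.toMatrix' (W₁.projection W₂ h), fun v hv => ?_, fun v hv => ?_, fun v => ?_⟩
  · rw [LinearMap.toMatrix'_mulVec]
    exact Submodule.projection_apply_left h ⟨v, hv⟩
  · rw [LinearMap.toMatrix'_mulVec]
    exact (Submodule.projection_apply_eq_zero_iff h).2 hv
  · rw [LinearMap.toMatrix'_mulVec]
    exact Submodule.projection_apply_mem h v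

theorem matrix_eq_of_mulVec {e f : Matrix κ ι S} (h : ∀ v, e.mulVec v = f.mulVec v) : e = f :=
  Matrix.ext_of_mulVec_single fun _ => h _

/-- An idempotent `e` of the commutant gives the invariant summands `ker e` and `ker (1 - e)`;
conversely the projection of an invariant decomposition commutes with the family. This works over
any commutative ring, hence for both `k` and `A`. -/
theorem isIndecomposable_iff (M : Γ → Matrix ι ι S) :
    IsIndecomposable M ↔ Nonempty ι ∧ ∀ e ∈ intertwiners M M, e * e = e → e = 0 ∨ e = 1 := by
  refine and_congr_right fun _ => ⟨fun h e he hee => ?_, fun h W₁ W₂ h₁ h₂ hc => ?_⟩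
  · have hker : ∀ f ∈ intertwiners M M, IsInvariant M (LinearMap.ker f.mulVecLin) := by
      intro f hf g v hv
      rw [LinearMap.mem_ker, Matrix.mulVecLin_apply] at hv ⊢
      rw [Matrix.mulVec_mulVec, hf g, ← Matrix.mulVec_mulVec, hv, Matrix.mulVec_zero]
    have h1 : (1 - e) ∈ intertwiners M M := Submodule.sub_mem _ (fun g => by simp) he
    have hsum : ∀ v, v = (1 - e).mulVec v + e.mulVec v := fun v => by
      rw [← Matrix.add_mulVec, sub_add_cancel, Matrix.one_mulVec]
    have hc : IsCompl (LinearMap.ker e.mulVecLin) (LinearMap.ker (1 - e).mulVecLin) := by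
      refine IsCompl.of_le (fun v hv => ?_) fun v _ => ?_
      · rw [Submodule.mem_inf, LinearMap.mem_ker, LinearMap.mem_ker, Matrix.mulVecLin_apply,
          Matrix.mulVecLin_apply] at hv
        rw [Submodule.mem_bot, hsum v, hv.1, hv.2, add_zero]
      · rw [hsum v]
        refine Submodule.add_mem_sup ?_ ?_
        · rw [LinearMap.mem_ker, Matrix.mulVecLin_apply, Matrix.mulVec_mulVec, mul_sub, hee, mul_one,
            sub_self, Matrix.zero_mulVec]
        · rw [LinearMap.mem_ker, Matrix.mulVecLin_apply, Matrix.mulVec_mulVec, sub_mul, hee, one_mul,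
            sub_self, Matrix.zero_mulVec]
    rcases h _ _ (hker _ he) (hker _ h1) hc with h0 | h0
    · right
      refine matrix_eq_of_mulVec fun v => ?_
      have : (1 - e).mulVec v ∈ LinearMap.ker e.mulVecLin := by
        rw [LinearMap.mem_ker, Matrix.mulVecLin_apply, Matrix.mulVec_mulVec, mul_sub, hee, mul_one,
          sub_self, Matrix.zero_mulVec]
      rw [h0, Submodule.mem_bot, Matrix.sub_mulVec, sub_eq_zero] at this
      exact this.symm
    · left
      refine matrix_eq_of_mulVec fun v => ?_
      have : e.mulVec v ∈ LinearMap.ker (1 - e).mulVecLin := by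
        rw [LinearMap.mem_ker, Matrix.mulVecLin_apply, Matrix.mulVec_mulVec, sub_mul, hee, one_mul,
          sub_self, Matrix.zero_mulVec]
      rw [h0, Submodule.mem_bot] at this
      rw [this, Matrix.zero_mulVec]
  · obtain ⟨e, he1, he2, he⟩ := exists_projection_matrix hc
    have hee : e * e = e := matrix_eq_of_mulVec fun v => by
      rw [← Matrix.mulVec_mulVec, he1 _ (he v)]
    have hint : e ∈ intertwiners M M := by
      intro g
      refine matrix_eq_of_mulVec fun v => ?_
      obtain ⟨v₁, hv₁, v₂, hv₂, rfl⟩ := Submodule.mem_sup.1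
        (show v ∈ W₁ ⊔ W₂ by rw [hc.sup_eq_top]; trivial)
      rw [← Matrix.mulVec_mulVec, ← Matrix.mulVec_mulVec, Matrix.mulVec_add, Matrix.mulVec_add,
        Matrix.mulVec_add, he1 _ hv₁, he2 _ hv₂, he1 _ (h₁ g _ hv₁), he2 _ (h₂ g _ hv₂), add_zero,
        add_zero]
    rcases h e hint hee with rfl | rfl
    · left
      rw [eq_bot_iff]
      intro v hv
      rw [Submodule.mem_bot, ← he1 v hv, Matrix.zero_mulVec]
    · right
      rw [eq_bot_iff]
      intro v hv
      rw [Submodule.mem_bot, ← he2 v hv, Matrix.one_mulVec]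

end Families

/-! ### Schur, Burnside and absolute irreducibility -/

section AbsoluteIrreducibility

universe w

variable {F : Type w} [Field F] {ι : Type*} [Fintype ι] {Γ : Type*} {M : Γ → Matrix ι ι F}

theorem IsAbsIrred.isIrred (h : IsAbsIrred M) : IsIrred M := by
  have := h F
  simpa using this

variable [DecidableEq ι]

/-- Schur's lemma for absolutely irreducible families. -/
theorem IsAbsIrred.exists_eq_smul_one (h : IsAbsIrred M) {e : Matrix ι ι F}
    (he : e ∈ intertwiners M M) : ∃ c : F, e = c • (1 : Matrix ι ι F) := by
  obtain ⟨⟨i⟩, h1⟩ := h (AlgebraicClosure F)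
  let L := AlgebraicClosure F
  let e' : Matrix ι ι L := e.map (algebraMap F L)
  have : Nonempty ι := ⟨i⟩
  obtain ⟨c, hc⟩ := Module.End.exists_eigenvalue e'.mulVecLin
  obtain ⟨v, hv⟩ := hc.exists_hasEigenvector
  have hW := h1 (Module.End.eigenspace e'.mulVecLin c) (fun g u hu => by
    rw [Module.End.mem_eigenspace_iff, Matrix.mulVecLin_apply] at hu ⊢
    rw [Matrix.mulVec_mulVec]
    simp only [e'] at hu ⊢
    rw [← Matrix.map_mul, he g, Matrix.map_mul, ← Matrix.mulVec_mulVec, hu, Matrix.mulVec_smul])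
  have htop : Module.End.eigenspace e'.mulVecLin c = ⊤ := hW.resolve_left fun h0 => by
    have : v ∈ Module.End.eigenspace e'.mulVecLin c := hv.1
    rw [h0, Submodule.mem_bot] at this
    exact hv.2 this
  have hec : e' = c • (1 : Matrix ι ι L) := by
    refine matrix_eq_of_mulVec fun u => ?_
    have : u ∈ Module.End.eigenspace e'.mulVecLin c := by rw [htop]; trivial
    rw [Module.End.mem_eigenspace_iff, Matrix.mulVecLin_apply] at this
    rw [this, Matrix.smul_mulVec, Matrix.one_mulVec]
  have hinj : Function.Injective (algebraMap F L) := (algebraMap F L).injective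
  -- The eigenvalue, found in the algebraic closure, is a diagonal entry of `e` and so lies in `F`.
  refine ⟨e i i, ?_⟩
  have hci : algebraMap F L (e i i) = c := by
    have := congrFun (congrFun hec i) i
    simpa [e'] using this
  ext x y
  apply hinj
  have := congrFun (congrFun hec x) y
  rw [← hci] at this
  rcases eq_or_ne x y with rfl | hxy
  · simpa [e'] using this
  · simpa [e', hxy] using this

/-- **Burnside's theorem**: an irreducible family with scalar commutant generates the full matrix
algebra. -/
theorem adjoin_eq_top_of_isIrred (h : IsIrred M)
    (hs : ∀ e ∈ intertwiners M M, ∃ c : F, e = c • (1 : Matrix ι ι F)) :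
    Algebra.adjoin F (Set.range fun g => Matrix.toLin' (M g)) = ⊤ := by
  set R := Algebra.adjoin F (Set.range fun g => Matrix.toLin' (M g)) with hR
  have hMR : ∀ g, Matrix.toLin' (M g) ∈ R := fun g => Algebra.subset_adjoin ⟨g, rfl⟩
  have := h.1
  have : IsSimpleModule R (ι → F) := by
    rw [isSimpleModule_iff]
    refine { exists_pair_ne := ⟨⊥, ⊤, bot_ne_top⟩, eq_bot_or_eq_top := fun W => ?_ }
    have := h.2 (W.restrictScalars F) fun g v hv =>
      W.smul_mem (⟨_, hMR g⟩ : R) hv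
    simpa using this
  have hscalar : ∀ φ : Module.End R (ι → F), ∃ c : F, ∀ v, φ v = c • v := by
    intro φ
    let φ' : (ι → F) →ₗ[F] (ι → F) := φ.restrictScalars F
    obtain ⟨c, hc⟩ := hs (LinearMap.toMatrix' φ') (fun g => by
      refine matrix_eq_of_mulVec fun v => ?_
      rw [← Matrix.mulVec_mulVec, ← Matrix.mulVec_mulVec, LinearMap.toMatrix'_mulVec,
        LinearMap.toMatrix'_mulVec]
      exact φ.map_smul (⟨_, hMR g⟩ : R) v)
    refine ⟨c, fun v => ?_⟩
    have := LinearMap.toMatrix'_mulVec φ' v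
    rw [hc, Matrix.smul_mulVec, Matrix.one_mulVec] at this
    exact this.symm
  refine eq_top_iff.2 fun f _ => ?_
  classical
  -- Endomorphisms commuting with `R` are scalars, so any `F`-linear `f` is linear over them;
  -- density at the standard basis then gives an element of `R` equal to `f`.
  obtain ⟨r, hr⟩ := jacobson_density (R := R) (M := ι → F)
    { toFun := f
      map_add' := f.map_add
      map_smul' := fun φ v => by
        obtain ⟨c, hc⟩ := hscalar φ
        simp only [Module.End.smul_def, RingHom.id_apply, hc, map_smul] }
    (Finset.univ.image fun i => Pi.single i (1 : F))
  have : f = r := by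
    refine LinearMap.pi_ext' fun i => LinearMap.ext_ring ?_
    exact hr _ (Finset.mem_image_of_mem _ (Finset.mem_univ i))
  rw [this]
  exact r.2

/-- By Burnside, a subspace over `L` that is invariant under the family is invariant under all
matrices with entries in `F`, and the elementary ones carry a nonzero vector to every basis vector.
-/
theorem isAbsIrred_of_isIrred (h : IsIrred M)
    (hs : ∀ e ∈ intertwiners M M, ∃ c : F, e = c • (1 : Matrix ι ι F)) : IsAbsIrred M := by
  intro L _ _
  refine ⟨h.1, fun W hW => ?_⟩
  have htop := adjoin_eq_top_of_isIrred h hs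
  have hall : ∀ f : Module.End F (ι → F), ∀ v ∈ W,
      ((LinearMap.toMatrix' f).map (algebraMap F L)).mulVec v ∈ W := by
    intro f
    have hf : f ∈ Algebra.adjoin F (Set.range fun g => Matrix.toLin' (M g)) := by
      rw [htop]; trivial
    induction hf using Algebra.adjoin_induction with
    | mem f hf =>
      obtain ⟨g, rfl⟩ := hf
      rw [LinearMap.toMatrix'_toLin']
      exact hW g
    | algebraMap c =>
      intro v hv
      have : (LinearMap.toMatrix' (algebraMap F (Module.End F (ι → F)) c)).map (algebraMap F L) =
          algebraMap F L c • (1 : Matrix ι ι L) := by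
        rw [LinearMap.toMatrix'_algebraMap]
        ext x y
        rcases eq_or_ne x y with rfl | hxy <;> simp [*]
      rw [this, Matrix.smul_mulVec, Matrix.one_mulVec]
      exact W.smul_mem _ hv
    | add f g _ _ hf hg =>
      intro v hv
      rw [map_add, Matrix.map_add _ (map_add _), Matrix.add_mulVec]
      exact W.add_mem (hf v hv) (hg v hv)
    | mul f g _ _ hf hg =>
      intro v hv
      rw [LinearMap.toMatrix'_mul, Matrix.map_mul, ← Matrix.mulVec_mulVec]
      exact hf _ (hg v hv)
  rw [or_iff_not_imp_left]
  intro hne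
  obtain ⟨w, hw, hw0⟩ := W.ne_bot_iff.1 hne
  obtain ⟨j, hj⟩ := Function.ne_iff.1 hw0
  rw [eq_top_iff]
  intro u _
  have hsingle : ∀ i, Pi.single i (1 : L) ∈ W := by
    intro i
    have h1 := W.smul_mem (w j)⁻¹ (hall (Matrix.toLin' (Matrix.single i j 1)) w hw)
    rw [LinearMap.toMatrix'_toLin'] at h1
    convert h1 using 1
    rw [Matrix.map_single, map_one]
    ext x
    rcases eq_or_ne i x with rfl | hx
    · simp [Matrix.single_mulVec, inv_mul_cancel₀ hj]
    · simp [Matrix.single_mulVec, hx.symm]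
  rw [pi_eq_sum_univ' u]
  exact W.sum_mem fun i _ => W.smul_mem _ (by convert hsingle i using 1)

/-- A criterion internal to `F`, so that `k` and `K` can be compared without comparing their
extension fields. -/
theorem isAbsIrred_iff : IsAbsIrred M ↔
    IsIrred M ∧ ∀ e ∈ intertwiners M M, ∃ c : F, e = c • (1 : Matrix ι ι F) :=
  ⟨fun h => ⟨h.isIrred, fun _ he => h.exists_eq_smul_one he⟩, fun h => isAbsIrred_of_isIrred h.1 h.2⟩

end AbsoluteIrreducibility

/-! ### Primitive vectors over the valuation ring -/

section Primitive

variable {k : Type*} [Field k] {A : Subalgebra k (PowerSeries k)}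

/-- Such an element is not a unit, so it lies in the maximal ideal, which `h` generates. The point
is that the quotient stays in `A`. -/
theorem IsDiscreteValuationSubring.exists_eq_X_mul (hA : IsDiscreteValuationSubring A) {a : A}
    (h : PowerSeries.constantCoeff (a : PowerSeries k) = 0) :
    ∃ b : A, a = ⟨PowerSeries.X, hA.X_mem⟩ * b := by
  have := hA.isDVR
  have hu : ¬IsUnit a := fun hu => by
    have h1 := (hu.map A.val).map (PowerSeries.constantCoeff (R := k))
    change IsUnit (PowerSeries.constantCoeff (a : PowerSeries k)) at h1
    rw [h] at h1
    exact not_isUnit_zero h1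
  rw [← mem_nonunits_iff, ← IsLocalRing.mem_maximalIdeal, hA.irreducible_X.maximalIdeal_eq,
    Ideal.mem_span_singleton] at hu
  exact hu

variable {ι : Type*}

/-- All entries are divided by `h` together until one has nonzero constant term; a nonzero
coefficient of degree `N` bounds the number of divisions. -/
theorem IsDiscreteValuationSubring.exists_eq_X_pow_mul (hA : IsDiscreteValuationSubring A) (N : ℕ) :
    ∀ w : ι → A, (∃ x, PowerSeries.coeff N (w x : PowerSeries k) ≠ 0) →
      ∃ (m : ℕ) (w' : ι → A), (∀ x, w x = ⟨PowerSeries.X, hA.X_mem⟩ ^ m * w' x) ∧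
        ∃ x, PowerSeries.constantCoeff (w' x : PowerSeries k) ≠ 0 := by
  induction N with
  | zero => exact fun w hw => ⟨0, w, fun x => by rw [pow_zero, one_mul], by simpa using hw⟩
  | succ N ih =>
    intro w hw
    by_cases h0 : ∃ x, PowerSeries.constantCoeff (w x : PowerSeries k) ≠ 0
    · exact ⟨0, w, fun x => by rw [pow_zero, one_mul], h0⟩
    · push Not at h0
      choose w' hw' using fun x => hA.exists_eq_X_mul (h0 x)
      obtain ⟨m, w'', h1, h2⟩ := ih w' (by
        obtain ⟨x, hx⟩ := hw
        refine ⟨x, ?_⟩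
        rw [hw' x] at hx
        change PowerSeries.coeff (N + 1) (PowerSeries.X * (w' x : PowerSeries k)) ≠ 0 at hx
        rwa [PowerSeries.coeff_succ_X_mul] at hx)
      exact ⟨m + 1, w'', fun x => by rw [hw' x, h1 x, pow_succ', mul_assoc], h2⟩

variable [Finite ι] {K : Type*} [Field K] [Algebra A K] [IsFractionRing A K]

/-- A nonzero vector has a multiple with entries in `A` whose reduction is nonzero. -/
theorem IsDiscreteValuationSubring.exists_primitive (hA : IsDiscreteValuationSubring A) {v : ι → K}
    (hv : v ≠ 0) : ∃ c : K, ∃ w : ι → A, (∀ x, c * v x = algebraMap A K (w x)) ∧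
      ∃ x, PowerSeries.constantCoeff (w x : PowerSeries k) ≠ 0 := by
  obtain ⟨a, ha⟩ := IsLocalization.exist_integer_multiples_of_finite (nonZeroDivisors A) v
  choose u hu using ha
  obtain ⟨x, hx⟩ := Function.ne_iff.1 hv
  have hux : (u x : PowerSeries k) ≠ 0 := by
    intro h0
    have h1 : u x = 0 := Subtype.ext h0
    have h2 := hu x
    rw [h1, map_zero, Algebra.smul_def, eq_comm, mul_eq_zero, IsFractionRing.to_map_eq_zero_iff] at h2
    exact h2.elim (nonZeroDivisors.ne_zero a.2) hx
  obtain ⟨N, hN⟩ : ∃ N, PowerSeries.coeff N (u x : PowerSeries k) ≠ 0 := by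
    by_contra! h
    exact hux (PowerSeries.ext h)
  obtain ⟨m, w, hw, hw'⟩ := hA.exists_eq_X_pow_mul N u ⟨x, hN⟩
  refine ⟨(algebraMap A K ⟨PowerSeries.X, hA.X_mem⟩ ^ m)⁻¹ * algebraMap A K a, w, fun y => ?_, hw'⟩
  have hX : algebraMap A K ⟨PowerSeries.X, hA.X_mem⟩ ^ m ≠ 0 := by
    refine pow_ne_zero _ fun h => ?_
    rw [IsFractionRing.to_map_eq_zero_iff] at h
    exact PowerSeries.X_ne_zero (congrArg Subtype.val h)
  have := hu y
  rw [Algebra.smul_def, hw y, map_mul, map_pow] at this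
  rw [mul_assoc, ← this, inv_mul_cancel_left₀ hX]

end Primitive

/-! ### Transfer of indecomposability and irreducibility -/

section Transfer

/-- In the coefficient of degree `m` of `e * e`, each product has the zero constant coefficient on
the right or a left factor of degree below `m`, zero by induction. -/
theorem eq_zero_of_mul_self {k : Type*} [Field k] {ι : Type*} [Fintype ι]
    {e : Matrix ι ι (PowerSeries k)} (he : e * e = e)
    (h0 : matCoeff 0 e = 0) : e = 0 := by
  refine matCoeff_ext fun m => ?_
  have hz : matCoeff m (0 : Matrix ι ι (PowerSeries k)) = 0 := by ext; simp [matCoeff]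
  rw [hz]
  induction m using Nat.strong_induction_on with
  | _ m ih =>
    rw [← he, matCoeff_mul]
    refine Finset.sum_eq_zero fun p hp => ?_
    rw [Finset.HasAntidiagonal.mem_antidiagonal] at hp
    rcases Nat.eq_zero_or_pos p.2 with h | h
    · rw [h, h0, Matrix.mul_zero]
    · rw [ih p.1 (by omega) (by ext; simp [matCoeff]), Matrix.zero_mul]

variable {k : Type*} [Field k] [CharZero k] {n : ℕ} {lam : k} {Φ : NCSeries k}
  {ι : Type*} [Fintype ι] [DecidableEq ι]
  {A : Subalgebra k (PowerSeries k)} {ρ : InfBraidAlgebra k n →ₐ[k] Matrix ι ι k}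
  {R : BraidGroup n →* Matrix ι ι A}

/-- Reduction at `h = 0` sends idempotents of the commutant over `A` to idempotents of the commutant
of `ρ`. It detects `0`, and applied to `1 - e` also `1`. Conversely, idempotents over `k` are
constant idempotents over `A`. -/
theorem isIndecomposable_iff_of_isPhiHatOver (hn : 2 ≤ n) (hlam : lam ≠ 0)
    (hΦ : IsAssociator lam Φ) (h : IsPhiHatOver A lam Φ ρ R) :
    IsIndecomposable ρ ↔ IsIndecomposable R := by
  rw [isIndecomposable_iff, isIndecomposable_iff, intertwiners_eq hn hlam hΦ h h]
  refine and_congr_right fun _ => ⟨fun hρ e he hee => ?_, fun hR e he hee => ?_⟩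
  · have he' := (mem_intertwiners_algebraMap_iff e).1 he
    have hee' : e.map A.val * e.map A.val = e.map A.val := by rw [← Matrix.map_mul, hee]
    have h1 : matCoeff 0 (1 : Matrix ι ι (PowerSeries k)) = 1 := by
      ext x y
      rcases eq_or_ne x y with rfl | hxy <;> simp [matCoeff, *]
    have hm1 : (1 : Matrix ι ι A).map A.val = 1 := Matrix.map_one _ (map_zero _) (map_one _)
    have hm0 : (0 : Matrix ι ι A).map A.val = 0 := Matrix.map_zero _ (map_zero _)
    rcases hρ (matCoeff 0 (e.map A.val)) (he' 0) (by rw [← matCoeff_zero_mul, hee']) with h0 | h0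
    · left
      apply map_val_injective
      simp only [hm0]
      exact eq_zero_of_mul_self hee' h0
    · right
      apply map_val_injective
      simp only [hm1]
      refine (sub_eq_zero.1 (eq_zero_of_mul_self ?_ ?_)).symm
      · rw [mul_sub, mul_one, sub_mul, one_mul, hee', sub_self, sub_zero]
      · have : matCoeff 0 (1 - e.map A.val) =
            matCoeff 0 (1 : Matrix ι ι (PowerSeries k)) - matCoeff 0 (e.map A.val) := by
          ext; simp [matCoeff]
        rw [this, h0, h1, sub_self]
  · have hinj : Function.Injective fun f : Matrix ι ι k => f.map (algebraMap k A) :=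
      Matrix.map_injective (algebraMap k A).injective
    have := hR (e.map (algebraMap k A)) (fun x => by rw [← Matrix.map_mul, he x, Matrix.map_mul])
      (by rw [← Matrix.map_mul, hee])
    refine this.imp (fun h0 => hinj ?_) fun h0 => hinj ?_
    · simp only [h0, Matrix.map_zero _ (map_zero _)]
    · simp only [h0, Matrix.map_one _ (map_zero _) (map_one _)]

variable {K : Type*} [Field K] [Algebra k K] [Algebra A K] [IsScalarTower k A K]

/-- An invariant subspace of `ρ` stays invariant after extension to `K`, since each coefficient of
`R g` lies in the image of `ρ`. -/
theorem IsIrred.of_fraction (hΦ : IsAssociator lam Φ) (h : IsPhiHatOver A lam Φ ρ R)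
    (hR : IsIrred (mapRep (algebraMap A K) R)) : IsIrred ρ := by
  refine ⟨hR.1, fun W hW => ?_⟩
  obtain ⟨W', hc⟩ := W.exists_isCompl
  obtain ⟨p, hp1, hp2, hp⟩ := exists_projection_matrix hc
  -- Invariance of `W` as a matrix identity, which can be checked coefficientwise for `R g`; the
  -- complement `W'` need not be invariant.
  have hρ : ∀ x, (1 - p) * (ρ x * p) = 0 := fun x => matrix_eq_of_mulVec fun v => by
    rw [← Matrix.mulVec_mulVec, ← Matrix.mulVec_mulVec, Matrix.sub_mulVec, Matrix.one_mulVec,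
      hp1 _ (hW x _ (hp v)), sub_self, Matrix.zero_mulVec]
  let q : Matrix ι ι A := (1 - p).map (algebraMap k A)
  have hRA : ∀ g, q * (R g * p.map (algebraMap k A)) = 0 := by
    intro g
    apply map_val_injective
    refine matCoeff_ext fun m => ?_
    simp only [Matrix.map_mul]
    rw [h.map_val hΦ, matCoeff_mul]
    have hz : matCoeff m ((0 : Matrix ι ι A).map A.val) = 0 := by ext; simp [matCoeff]
    rw [hz]
    refine Finset.sum_eq_zero fun a _ => ?_
    rw [matCoeff_map_val_map]
    split_ifs
    · rw [matCoeff_mul, Finset.mul_sum]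
      refine Finset.sum_eq_zero fun b _ => ?_
      rw [matCoeff_map_val_map, matCoeff_seriesRep]
      split_ifs
      · exact hρ _
      · rw [mul_zero, mul_zero]
    · rw [zero_mul]
  let P : Matrix ι ι K := p.map (algebraMap k K)
  let Q : Matrix ι ι K := (1 - p).map (algebraMap k K)
  have hQ : Q = 1 - P := by
    rw [show Q = (1 : Matrix ι ι k).map (algebraMap k K) - P from Matrix.map_sub _ (map_sub _) _ _,
      Matrix.map_one _ (map_zero _) (map_one _)]
  have hQP : Q * P = 0 := by
    have : (1 - p) * p = 0 := by simpa using hρ 1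
    rw [← Matrix.map_mul, this, Matrix.map_zero _ (map_zero _)]
  have hK : ∀ g, Q * (mapRep (algebraMap A K) R g * P) = 0 := by
    intro g
    have := congrArg (fun f => f.map (algebraMap A K)) (hRA g)
    simp only [q, Matrix.map_mul, map_algebraMap_map, Matrix.map_zero _ (map_zero _)] at this
    exact this
  have hinj : Function.Injective fun f : Matrix ι ι k => f.map (algebraMap k K) :=
    Matrix.map_injective (algebraMap k K).injective
  -- The kernel of `Q = 1 - P` is the image of `P`, that is, the extension of `W` to `K`.
  rcases hR.2 (LinearMap.ker Q.mulVecLin) (fun g v hv => by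
    rw [LinearMap.mem_ker, Matrix.mulVecLin_apply] at hv ⊢
    have hv' : v = P.mulVec v := by
      rw [hQ, Matrix.sub_mulVec, Matrix.one_mulVec, sub_eq_zero] at hv
      exact hv
    rw [hv', Matrix.mulVec_mulVec, Matrix.mulVec_mulVec, Matrix.mul_assoc, hK, Matrix.zero_mulVec]) with h0 | h0
  · left
    have hP : p = 0 := by
      apply hinj
      simp only [Matrix.map_zero _ (map_zero (algebraMap k K))]
      refine matrix_eq_of_mulVec fun v => ?_
      have : P.mulVec v ∈ LinearMap.ker Q.mulVecLin := by
        rw [LinearMap.mem_ker, Matrix.mulVecLin_apply, Matrix.mulVec_mulVec, hQP, Matrix.zero_mulVec]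
      rw [h0, Submodule.mem_bot] at this
      rw [Matrix.zero_mulVec]
      exact this
    rw [eq_bot_iff]
    intro v hv
    rw [Submodule.mem_bot, ← hp1 v hv, hP, Matrix.zero_mulVec]
  · right
    have hP : 1 - p = 0 := by
      apply hinj
      simp only [Matrix.map_zero _ (map_zero (algebraMap k K))]
      refine matrix_eq_of_mulVec fun v => ?_
      have : v ∈ LinearMap.ker Q.mulVecLin := by rw [h0]; trivial
      rw [Matrix.zero_mulVec]
      exact this
    rw [eq_top_iff]
    intro v _
    have := hp v
    rwa [← sub_eq_zero.1 hP, Matrix.one_mulVec] at this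

/-- The reduction at `h = 0` of the vectors with entries in `A` in a subspace of `K^ι`. -/
def reduction (W : Submodule K (ι → K)) : Submodule k (ι → k) where
  carrier := {v | ∃ w : ι → A, (fun x => algebraMap A K (w x)) ∈ W ∧
    ∀ x, v x = PowerSeries.constantCoeff (w x : PowerSeries k)}
  zero_mem' := ⟨0, by convert W.zero_mem using 1; ext x; simp, fun x => by simp⟩
  add_mem' := by
    rintro _ _ ⟨w, hw, h⟩ ⟨w', hw', h'⟩
    refine ⟨w + w', ?_, fun x => by simp [h, h']⟩
    convert W.add_mem hw hw' using 1
    ext x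
    simp
  smul_mem' := by
    rintro c _ ⟨w, hw, h⟩
    refine ⟨c • w, ?_, fun x => by simp [h, PowerSeries.smul_eq_C_mul]⟩
    convert W.smul_mem (algebraMap k K c) hw using 1
    ext x
    simp [Algebra.smul_def, IsScalarTower.algebraMap_apply k A K]

variable [IsFractionRing A K]

/-- The lattice of vectors of `W` with entries in `A` is stable under the braids and also under
`(σᵢ² - 1)/h`. Modulo `h` these operators become `sᵢ` and `2λ t_{i,i+1}`, which generate `𝔅ₙ`. -/
theorem isInvariant_reduction (hn : 2 ≤ n) (hlam : lam ≠ 0)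
    (hΦ : IsAssociator lam Φ) (hA : IsDiscreteValuationSubring A) (h : IsPhiHatOver A lam Φ ρ R)
    {W : Submodule K (ι → K)} (hW : IsInvariant (mapRep (algebraMap A K) R) W) :
    IsInvariant ρ (reduction (A := A) W) := by
  let S : Subalgebra k (InfBraidAlgebra k n) :=
    { carrier := {x | ∀ v ∈ reduction (A := A) W, (ρ x).mulVec v ∈ reduction (A := A) W}
      mul_mem' := fun {a b} ha hb v hv => by
        rw [map_mul, ← Matrix.mulVec_mulVec]
        exact ha _ (hb _ hv)
      add_mem' := fun {a b} ha hb v hv => by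
        rw [map_add, Matrix.add_mulVec]
        exact Submodule.add_mem _ (ha _ hv) (hb _ hv)
      algebraMap_mem' := fun c v hv => by
        rw [AlgHom.commutes, Algebra.algebraMap_eq_smul_one, Matrix.smul_mulVec, Matrix.one_mulVec]
        exact Submodule.smul_mem _ _ hv }
  have hWA : ∀ (g : BraidGroup n) (w : ι → A), (fun x => algebraMap A K (w x)) ∈ W →
      (fun x => algebraMap A K ((R g).mulVec w x)) ∈ W := by
    intro g w hw
    convert hW g _ hw using 1
    ext x
    exact RingHom.map_mulVec _ _ _ _
  have hcoe : ∀ (g : BraidGroup n) (w : ι → A) x, ((R g).mulVec w x : PowerSeries k) =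
      ∑ y, seriesRep ρ (braidSeries n hΦ g) x y * (w y : PowerSeries k) := by
    intro g w x
    rw [Matrix.mulVec, dotProduct, AddSubmonoidClass.coe_finsetSum]
    exact Finset.sum_congr rfl fun y _ => by
      rw [MulMemClass.coe_mul, (isPhiHatOver_iff hΦ ρ R).1 h]
  have hc0 : ∀ g (w : ι → A) x, PowerSeries.coeff 0 ((R g).mulVec w x : PowerSeries k) =
      ∑ y, ρ (PowerSeries.coeff 0 (braidSeries n hΦ g)) x y *
        PowerSeries.coeff 0 (w y : PowerSeries k) := by
    intro g w x
    rw [hcoe, map_sum]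
    exact Finset.sum_congr rfl fun y _ => by rw [coeff_zero_mul', coeff_seriesRep]
  have hc1 : ∀ g (w : ι → A) x, PowerSeries.coeff 1 ((R g).mulVec w x : PowerSeries k) =
      ∑ y, ρ (PowerSeries.coeff 0 (braidSeries n hΦ g)) x y *
          PowerSeries.coeff 1 (w y : PowerSeries k) +
        ∑ y, ρ (PowerSeries.coeff 1 (braidSeries n hΦ g)) x y *
          PowerSeries.coeff 0 (w y : PowerSeries k) := by
    intro g w x
    rw [hcoe, map_sum, ← Finset.sum_add_distrib]
    exact Finset.sum_congr rfl fun y _ => by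
      rw [coeff_one_mul', coeff_seriesRep, coeff_seriesRep]
  have hS : S = ⊤ := by
    refine subalgebra_eq_top_of_adjacent hn (fun i => ?_) fun i => ?_
    · rintro v ⟨w, hw, hv⟩
      let g := sigma i * sigma i
      have hg : braidSeries n hΦ g = drinfeldElt lam Φ i * drinfeldElt lam Φ i := by
        rw [map_mul, braidSeries_sigma]
      -- `u = (σᵢ² - 1) w` is divisible by `h` in `A^ι`, and the quotient remains in `W` because `h`
      -- is invertible in `K`.
      let u : ι → A := (R g).mulVec w - w
      have hu0 : ∀ x, PowerSeries.constantCoeff (u x : PowerSeries k) = 0 := by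
        intro x
        rw [← PowerSeries.coeff_zero_eq_constantCoeff_apply]
        simp only [u, Pi.sub_apply, AddSubgroupClass.coe_sub, map_sub, hc0, hg,
          coeff_zero_drinfeldElt_sq hΦ, map_one]
        simp [Matrix.one_apply]
      have hu1 : ∀ x, PowerSeries.coeff 1 (u x : PowerSeries k) =
          (2 * lam) * (ρ (t k (lo i) (hi i))).mulVec v x := by
        intro x
        simp only [u, Pi.sub_apply, AddSubgroupClass.coe_sub, map_sub, hc1, hg,
          coeff_zero_drinfeldElt_sq hΦ, coeff_one_drinfeldElt_sq hΦ, map_one, map_smul]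
        simp [Matrix.one_apply, Matrix.mulVec, dotProduct, hv, Finset.mul_sum, mul_assoc]
      choose u' hu' using fun x => hA.exists_eq_X_mul (hu0 x)
      have hu'W : (fun x => algebraMap A K (u' x)) ∈ W := by
        have hX : algebraMap A K ⟨PowerSeries.X, hA.X_mem⟩ ≠ 0 := by
          intro h
          rw [IsFractionRing.to_map_eq_zero_iff] at h
          exact PowerSeries.X_ne_zero (congrArg Subtype.val h)
        have huW : (fun x => algebraMap A K (u x)) ∈ W := by
          convert W.sub_mem (hWA g w hw) hw using 1
          ext x
          simp [u]
        convert W.smul_mem (algebraMap A K ⟨PowerSeries.X, hA.X_mem⟩)⁻¹ huW using 1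
        ext x
        rw [Pi.smul_apply, hu' x, map_mul, smul_eq_mul, inv_mul_cancel_left₀ hX]
      have hl : (2 * lam) ≠ 0 := mul_ne_zero two_ne_zero hlam
      have hmem : (2 * lam) • (ρ (t k (lo i) (hi i))).mulVec v ∈ reduction (A := A) W := by
        refine ⟨u', hu'W, fun x => ?_⟩
        rw [Pi.smul_apply, smul_eq_mul, ← hu1, hu' x]
        change PowerSeries.coeff (0 + 1) (PowerSeries.X * (u' x : PowerSeries k)) = _
        rw [PowerSeries.coeff_succ_X_mul, PowerSeries.coeff_zero_eq_constantCoeff_apply]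
      have := Submodule.smul_mem _ (2 * lam)⁻¹ hmem
      rwa [inv_smul_smul₀ hl] at this
    · rintro v ⟨w, hw, hv⟩
      refine ⟨_, hWA (sigma i) w hw, fun x => ?_⟩
      rw [← PowerSeries.coeff_zero_eq_constantCoeff_apply, hc0, braidSeries_sigma,
        coeff_zero_drinfeldElt hΦ, Matrix.mulVec, dotProduct]
      exact Finset.sum_congr rfl fun y _ => by
        rw [hv, PowerSeries.coeff_zero_eq_constantCoeff_apply]
  intro x v hv
  have hx : x ∈ S := by rw [hS]; trivial
  exact hx v hv

/-- A nonzero `W` contains a primitive vector, so its reduction is nonzero, hence everything. A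
proper `W` is killed by a nonzero linear form; made primitive, this form has a nonzero reduction
that kills the reduction of `W`, a contradiction. -/
theorem IsIrred.to_fraction (hn : 2 ≤ n) (hlam : lam ≠ 0)
    (hΦ : IsAssociator lam Φ) (hA : IsDiscreteValuationSubring A) (h : IsPhiHatOver A lam Φ ρ R)
    (hρ : IsIrred ρ) : IsIrred (mapRep (algebraMap A K) R) := by
  refine ⟨hρ.1, fun W hW => ?_⟩
  by_contra! hne
  have hbot : reduction (A := A) W ≠ ⊥ := by
    obtain ⟨v, hv, hv0⟩ := W.ne_bot_iff.1 hne.1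
    obtain ⟨c, w, hw, x, hx⟩ := hA.exists_primitive hv0
    refine (Submodule.ne_bot_iff _).2 ⟨_, ⟨w, ?_, fun x => rfl⟩, fun h0 => hx (congrFun h0 x)⟩
    convert W.smul_mem c hv using 1
    ext x
    exact (hw x).symm
  have htop := (hρ.2 _ (isInvariant_reduction hn hlam hΦ hA h hW)).resolve_left hbot
  obtain ⟨f, hf0, hf⟩ := Submodule.exists_le_ker_of_lt_top W (lt_top_iff_ne_top.2 hne.2)
  have hsum : ∀ v ∈ W, ∑ x, v x * f (Pi.single x 1) = 0 := by
    intro v hv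
    have h1 : f v = 0 := hf hv
    rw [← h1, LinearMap.pi_apply_eq_sum_univ f v]
    refine Finset.sum_congr rfl fun x _ => ?_
    rw [smul_eq_mul]
    congr 2
    ext y
    simp [Pi.single_apply, eq_comm]
  have hφ : (fun x => f (Pi.single x 1)) ≠ 0 := by
    intro h0
    apply hf0
    refine LinearMap.pi_ext' fun x => LinearMap.ext_ring ?_
    exact congrFun h0 x
  obtain ⟨c, φ, hφ1, x, hx⟩ := hA.exists_primitive hφ
  apply hx
  -- A lift to `W` of the basis vector at `x`; pairing it with the form `φ` and reducing gives the
  -- constant term of `φ x`, which was chosen nonzero.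
  obtain ⟨w, hw, hwv⟩ : Pi.single x 1 ∈ reduction (A := A) W := by rw [htop]; trivial
  have h1 := hsum _ hw
  have h2 : ∑ y, w y * φ y = 0 := by
    apply IsFractionRing.injective A K
    rw [map_zero, map_sum, ← mul_zero c, ← h1, Finset.mul_sum]
    refine Finset.sum_congr rfl fun y _ => ?_
    rw [map_mul, ← hφ1]
    ring
  have h3 := congrArg (fun a : A => PowerSeries.constantCoeff (a : PowerSeries k)) h2
  simp only [AddSubmonoidClass.coe_finsetSum, map_sum, MulMemClass.coe_mul, map_mul, ← hwv,
    ZeroMemClass.coe_zero, map_zero] at h3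
  simpa [Pi.single_apply] using h3

/-- The commutant over `K` is spanned by that over `k`; in the other direction the scalar is a
diagonal entry, hence in `k`. -/
theorem exists_eq_smul_one_iff (hn : 2 ≤ n) (hlam : lam ≠ 0) (hΦ : IsAssociator lam Φ)
    (h : IsPhiHatOver A lam Φ ρ R) (hι : Nonempty ι) :
    (∀ e ∈ intertwiners ρ ρ, ∃ c : k, e = c • (1 : Matrix ι ι k)) ↔
      ∀ e ∈ intertwiners (mapRep (algebraMap A K) R) (mapRep (algebraMap A K) R),
        ∃ c : K, e = c • (1 : Matrix ι ι K) := by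
  rw [intertwiners_fraction_eq hn hlam hΦ h h]
  constructor
  · intro hρ e he
    rw [← range_intertwinersBaseChange] at he
    obtain ⟨z, rfl⟩ := he
    induction z using TensorProduct.induction_on with
    | zero => exact ⟨0, by rw [map_zero, zero_smul]⟩
    | tmul a f =>
      obtain ⟨c, hc⟩ := hρ f f.2
      refine ⟨a * algebraMap k K c, ?_⟩
      rw [intertwinersBaseChange_tmul, hc]
      ext x y
      rcases eq_or_ne x y with rfl | hxy <;> simp [*]
    | add u v hu hv =>
      obtain ⟨a, ha⟩ := hu
      obtain ⟨b, hb⟩ := hv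
      exact ⟨a + b, by rw [map_add, ha, hb, add_smul]⟩
  · intro hR e he
    obtain ⟨c, hc⟩ := hR (e.map (algebraMap k K))
      (fun x => by rw [← Matrix.map_mul, he x, Matrix.map_mul])
    obtain ⟨i⟩ := hι
    refine ⟨e i i, ?_⟩
    have hci : algebraMap k K (e i i) = c := by
      have := congrFun (congrFun hc i) i
      simpa using this
    ext x y
    apply (algebraMap k K).injective
    have := congrFun (congrFun hc x) y
    rw [← hci] at this
    rcases eq_or_ne x y with rfl | hxy
    · simpa using this
    · simpa [hxy] using this

theorem isIrred_iff_of_isPhiHatOver (hn : 2 ≤ n) (hlam : lam ≠ 0) (hΦ : IsAssociator lam Φ)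
    (hA : IsDiscreteValuationSubring A) (h : IsPhiHatOver A lam Φ ρ R) :
    IsIrred ρ ↔ IsIrred (mapRep (algebraMap A K) R) :=
  ⟨fun hρ => hρ.to_fraction hn hlam hΦ hA h, fun hR => hR.of_fraction hΦ h⟩

theorem isAbsIrred_iff_of_isPhiHatOver (hn : 2 ≤ n) (hlam : lam ≠ 0) (hΦ : IsAssociator lam Φ)
    (hA : IsDiscreteValuationSubring A) (h : IsPhiHatOver A lam Φ ρ R) :
    IsAbsIrred ρ ↔ IsAbsIrred (mapRep (algebraMap A K) R) := by
  rw [isAbsIrred_iff, isAbsIrred_iff,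
    ← isIrred_iff_of_isPhiHatOver (K := K) hn hlam hΦ hA h]
  exact and_congr_right fun hρ => exists_eq_smul_one_iff hn hlam hΦ h hρ.1

end Transfer

end InfBraid

/-! ### The theorem -/

open InfBraid in
theorem theorem3 {k : Type*} [Field k] [CharZero k] (n : ℕ) (hn : 2 ≤ n)
    (lam : k) (hlam : lam ≠ 0) (Φ : NCSeries k) (hΦ : IsAssociator lam Φ) :
    -- the representation of the braid group over `k[[h]]` is well defined
    (∀ {ι : Type*} [Fintype ι] [DecidableEq ι] (ρ : InfBraidAlgebra k n →ₐ[k] Matrix ι ι k),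
      ∃! R : BraidGroup n →* Matrix ι ι (PowerSeries k), IsPhiHat lam Φ ρ R) ∧
    -- the ring `A`, and its field of fractions `K`
    ∀ (A : Subalgebra k (PowerSeries k)), IsDiscreteValuationSubring A →
      (∀ (N : ℕ), 0 < N → ∀ (ρ : InfBraidAlgebra k n →ₐ[k] Matrix (Fin N) (Fin N) k)
        (R : BraidGroup n →* Matrix (Fin N) (Fin N) (PowerSeries k)),
        IsPhiHat lam Φ ρ R → ∀ g x y, R g x y ∈ A) →
      ∀ (K : Type*) [Field K] [Algebra k K] [Algebra A K] [IsScalarTower k A K]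
        [IsFractionRing A K],
      (∀ {ι : Type*} [Fintype ι] [DecidableEq ι] (ρ : InfBraidAlgebra k n →ₐ[k] Matrix ι ι k),
        ∃! R : BraidGroup n →* Matrix ι ι A, IsPhiHatOver A lam Φ ρ R) ∧
      (∀ {ι : Type*} [Fintype ι] [DecidableEq ι] (ρ : InfBraidAlgebra k n →ₐ[k] Matrix ι ι k)
        (R : BraidGroup n →* Matrix ι ι A), IsPhiHatOver A lam Φ ρ R →
        (IsIndecomposable ρ ↔ IsIndecomposable R) ∧
        (IsIrred ρ ↔ IsIrred (mapRep (algebraMap A K) R)) ∧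
        (IsAbsIrred ρ ↔ IsAbsIrred (mapRep (algebraMap A K) R)) ∧
        IsPhiHatOver A lam Φ (dualAlg ρ) (dualGrp R)) ∧
      (∀ {ι κ : Type*} [Fintype ι] [DecidableEq ι] [Fintype κ] [DecidableEq κ]
        (ρ₁ : InfBraidAlgebra k n →ₐ[k] Matrix ι ι k)
        (ρ₂ : InfBraidAlgebra k n →ₐ[k] Matrix κ κ k)
        (R₁ : BraidGroup n →* Matrix ι ι A) (R₂ : BraidGroup n →* Matrix κ κ A),
        IsPhiHatOver A lam Φ ρ₁ R₁ → IsPhiHatOver A lam Φ ρ₂ R₂ →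
        IsPhiHatOver A lam Φ (dsumAlg ρ₁ ρ₂) (dsumGrp R₁ R₂) ∧
        IsPhiHatOver A lam Φ (tensorAlg ρ₁ ρ₂) (tensorGrp R₁ R₂) ∧
        -- `Hom_A = Hom_k ⊗ A`
        Function.Injective (intertwinersBaseChange ρ₁ ρ₂ A) ∧
        LinearMap.range (intertwinersBaseChange ρ₁ ρ₂ A) = intertwiners R₁ R₂ ∧
        -- `Hom_K = Hom_k ⊗ K`
        Function.Injective (intertwinersBaseChange ρ₁ ρ₂ K) ∧
        LinearMap.range (intertwinersBaseChange ρ₁ ρ₂ K) =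
          intertwiners (mapRep (algebraMap A K) R₁) (mapRep (algebraMap A K) R₂)) := by
  refine ⟨fun ρ => existsUnique_isPhiHat hΦ ρ, fun A hA hAR K _ _ _ _ _ =>
    ⟨fun ρ => existsUnique_isPhiHatOver hΦ hAR ρ, fun ρ R hR =>
      ⟨isIndecomposable_iff_of_isPhiHatOver hn hlam hΦ hR,
        isIrred_iff_of_isPhiHatOver hn hlam hΦ hA hR,
        isAbsIrred_iff_of_isPhiHatOver hn hlam hΦ hA hR, hR.dual hΦ⟩,
      fun ρ₁ ρ₂ R₁ R₂ h₁ h₂ => ⟨h₁.dsum hΦ h₂, h₁.tensor hΦ h₂,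
        intertwinersBaseChange_injective _ _ _, ?_, intertwinersBaseChange_injective _ _ _, ?_⟩⟩⟩
  · rw [range_intertwinersBaseChange, intertwiners_eq hn hlam hΦ h₁ h₂]
  · rw [range_intertwinersBaseChange, intertwiners_fraction_eq hn hlam hΦ h₁ h₂]
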